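/- Manifolds are smooth, Hausdorff, and may have boundary. Let $\Sigma_g$ ($g\ge 0$) be the closed connected orientable surface of genus $g$ and $N_g$ ($g\ge 1$) the closed connected non-orientable surface of genus $g$ (the connected sum of $g$ projective planes, equivalently the quotient of $\Sigma_{g-1}$, placed symmetrically about the origin in $\mathbb R^3$, by the antipodal map). Let $X$ be a compact connected $4$-manifold and $\Sigma$ a compact connected orientable $2$-manifold. A smooth map $f:X\to\Sigma$ is a *Lefschetz fibration* if 1. $\partial X=f^{-1}(\partial\Sigma)$; 2. the set $\mathrm{Crit}(f)$ of points where $df$ is not surjective lies in the interior of $X$; 3. for every $x\in\mathrm{Crit}(f)$ there are smooth charts $\varphi:U\to\mathbb C^2$ about $x$ and $\psi:V\to\mathbb C$ about $f(x)$, with open images and $f(U)\subset V$, such that $(\psi\circ f\circ\varphi^{-1})(z,w)=zw$ on $\varphi(U)$. It is *non-orientable of genus $g$* ($g\ge1$) if $X$ is non-orientable and $f^{-1}(y)$ is diffeomorphic to $N_g$ for every $y\in\Sigma\setminus f(\mathrm{Crit}(f))$; it is *orientable of genus $g$* if $X$ is orientable and $f^{-1}(y)$ is diffeomorphic to $\Sigma_g$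 for every such $y$. If $X$ is oriented, $x\in\mathrm{Crit}(f)$ is called *positive* (resp. *negative*) if $\varphi$ in (3) can be chosen orientation preserving (resp. reversing) with respect to the complex orientation of $\mathbb C^2$; $f$ is *achiral* if it has a negative critical point. The *standard orientation double cover* of $X$ is $\widetilde X=\{(p,o_p): p\in X,\ o_p \text{ an orientation of } T_pX\}$ with the projection $\pi(p,o_p)=p$. Its smooth structure is given by the charts $\varphi\circ\pi$ on $\{(p,o_p): p\in U,\ d\varphi_p \text{ carries } o_p \text{ to } o\}$, for the charts $(U,\varphi)$ of $X$ and the two orientations $o$ of $\mathbb R^4$. **Proposition 1.1.** Let $f:X\to\Sigma$ be a non-orientable Lefschetz fibration of genus $g$ and $\pi:\widetilde X\to X$ the standard orientation double cover. Then $f\circ\pi:\widetilde X\to\Sigma$ is an orientable Lefschetz fibration of genus $g-1$ (in particular $\widetilde X$ is a compact connected orientable smooth $4$-manifold). It has finitely many critical points and, for every orientation of $\widetilde X$, each of them is positive or negative, there are as many positive as negative ones, and $f\circ\pi$ is achiral whenever $f$ has a critical point. -/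

import Mathlib

open Set Filter Topology
open scoped Manifold ContDiff

noncomputable section

/-! ### Orientations of tangent spaces and of manifolds -/

/-- The linear map `A` is an isomorphism and carries the orientation `o` of `V` to the orientation
`o'` of `W`. -/
def MapsOrientation {V W : Type*} [AddCommGroup V] [Module ℝ V] [AddCommGroup W] [Module ℝ W]
    {n : ℕ} (A : V →ₗ[ℝ] W) (o : Orientation ℝ V (Fin n)) (o' : Orientation ℝ W (Fin n)) : Prop :=
  ∃ L : V ≃ₗ[ℝ] W, (L : V →ₗ[ℝ] W) = A ∧ Orientation.map (Fin n) L o = o'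

/-- The differential at `p` of a map `u` from a manifold to a vector space `F`, as a linear map from
the tangent space at `p` to `F`. -/
def differentialAt {E F H M : Type*} [NormedAddCommGroup E] [NormedSpace ℝ E]
    [NormedAddCommGroup F] [NormedSpace ℝ F] [TopologicalSpace H] (I : ModelWithCorners ℝ E H)
    [TopologicalSpace M] [ChartedSpace H M] (u : M → F) (p : M) : TangentSpace I p →L[ℝ] F :=
  mfderiv I 𝓘(ℝ, F) u p

/-- An orientation of a smooth `n`-manifold (possibly with boundary): a choice of an orientation
of every tangent space which varies continuously, that is, near every point `p` the differential
of the chart at `p` carries the chosen orientations to one and the same orientation of `ℝⁿ`. -/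
structure ManifoldOrientation {n : ℕ} {H : Type*} [TopologicalSpace H]
    (I : ModelWithCorners ℝ (EuclideanSpace ℝ (Fin n)) H)
    (M : Type*) [TopologicalSpace M] [ChartedSpace H M] where
  at_point : ∀ p : M, Orientation ℝ (TangentSpace I p) (Fin n)
  continuous' : ∀ p : M, ∃ o : Orientation ℝ (EuclideanSpace ℝ (Fin n)) (Fin n),
    ∀ᶠ q in 𝓝 p, MapsOrientation (differentialAt I (extChartAt I p) q).toLinearMap (at_point q) o

/-- A manifold is orientable if it has an orientation. -/
def IsOrientableManifold {n : ℕ} {H : Type*} [TopologicalSpace H]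
    (I : ModelWithCorners ℝ (EuclideanSpace ℝ (Fin n)) H)
    (M : Type*) [TopologicalSpace M] [ChartedSpace H M] : Prop :=
  Nonempty (ManifoldOrientation I M)

/-! ### The standard orientation double cover -/

/-- The image of an orientation of `ℝⁿ` under an invertible linear map `A` of `ℝⁿ` (see
`transportOrientation_eq_map`). -/
def transportOrientation {n : ℕ}
    (A : EuclideanSpace ℝ (Fin n) →L[ℝ] EuclideanSpace ℝ (Fin n))
    (o : Orientation ℝ (EuclideanSpace ℝ (Fin n)) (Fin n)) :
    Orientation ℝ (EuclideanSpace ℝ (Fin n)) (Fin n) :=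
  open Classical in if 0 < A.det then o else -o

theorem transportOrientation_eq_map {n : ℕ}
    (L : EuclideanSpace ℝ (Fin n) ≃L[ℝ] EuclideanSpace ℝ (Fin n))
    (o : Orientation ℝ (EuclideanSpace ℝ (Fin n)) (Fin n)) :
    transportOrientation (L : EuclideanSpace ℝ (Fin n) →L[ℝ] EuclideanSpace ℝ (Fin n)) o =
      Orientation.map (Fin n) L.toLinearEquiv o := by
  have hc : Fintype.card (Fin n) = Module.finrank ℝ (EuclideanSpace ℝ (Fin n)) := by simp
  unfold transportOrientation
  split_ifs with h
  · exact ((Orientation.map_eq_iff_det_pos o L.toLinearEquiv hc).2 h).symm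
  · refine ((Orientation.map_eq_neg_iff_det_neg o L.toLinearEquiv hc).2 ?_).symm
    have h0 : LinearMap.det (L.toLinearEquiv : EuclideanSpace ℝ (Fin n) →ₗ[ℝ] _) ≠ 0 :=
      (LinearEquiv.isUnit_det' L.toLinearEquiv).ne_zero
    exact lt_of_le_of_ne (not_lt.1 h) h0

theorem transportOrientation_comp {n : ℕ}
    {A B : EuclideanSpace ℝ (Fin n) →L[ℝ] EuclideanSpace ℝ (Fin n)}
    (hA : A.det ≠ 0) (hB : B.det ≠ 0)
    (o : Orientation ℝ (EuclideanSpace ℝ (Fin n)) (Fin n)) :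
    transportOrientation B (transportOrientation A o) = transportOrientation (B.comp A) o := by
  have h : (B.comp A).det = B.det * A.det := by
    simp [ContinuousLinearMap.det, ContinuousLinearMap.toLinearMap_comp, LinearMap.det_comp]
  unfold transportOrientation
  rw [h]
  rcases lt_or_gt_of_ne hA with hA | hA <;> rcases lt_or_gt_of_ne hB with hB | hB
  · simp only [hA.not_gt, hB.not_gt, mul_pos_of_neg_of_neg hB hA, if_true, if_false]
    exact neg_neg o
  · simp [hA.not_gt, hB, (mul_neg_of_pos_of_neg hB hA).not_gt]
  · simp [hA, hB.not_gt, (mul_neg_of_neg_of_pos hB hA).not_gt]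
  · simp [hA, hB, mul_pos hB hA]

section Cover

variable {n : ℕ} {H : Type*} [TopologicalSpace H]
  (I : ModelWithCorners ℝ (EuclideanSpace ℝ (Fin n)) H)
  (M : Type*) [TopologicalSpace M] [ChartedSpace H M]

/-- The points of the standard orientation double cover of `M`: pairs of a point of `M` and an
orientation of the tangent space at that point. -/
@[ext]
structure OrientationCover where
  point : M
  orientation : Orientation ℝ (TangentSpace I point) (Fin n)

/-- The projection of the standard orientation double cover. -/
def OrientationCover.proj (q : OrientationCover I M) : M := q.point

variable [IsManifold I 1 M]

variable {M} in
/-- The differential, at the point `p`, of the transition map from the chart `e` to the chart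
`e'`. In Mathlib the tangent space at `p` is `ℝⁿ`, read in the preferred chart `achart H p`; so
`chartChange I (achart H p) e p` is the differential of the chart `e` at `p`. -/
def chartChange (e e' : atlas H M) (p : M) :
    EuclideanSpace ℝ (Fin n) →L[ℝ] EuclideanSpace ℝ (Fin n) :=
  (tangentBundleCore I M).coordChange e e' p

variable {M}

theorem chartChange_comp (e e' e'' : atlas H M) {p : M} (h : p ∈ e.1.source)
    (h' : p ∈ e'.1.source) (h'' : p ∈ e''.1.source) :
    (chartChange I e' e'' p).comp (chartChange I e e' p) = chartChange I e e'' p := by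
  ext1 v
  exact (tangentBundleCore I M).coordChange_comp e e' e'' p ⟨⟨h, h'⟩, h''⟩ v

theorem chartChange_self (e : atlas H M) {p : M} (h : p ∈ e.1.source) :
    chartChange I e e p = ContinuousLinearMap.id ℝ _ := by
  ext1 v
  exact (tangentBundleCore I M).coordChange_self e p h v

theorem chartChange_det_ne_zero (e e' : atlas H M) {p : M} (h : p ∈ e.1.source)
    (h' : p ∈ e'.1.source) : (chartChange I e e' p).det ≠ 0 := by
  have h1 := chartChange_comp I e e' e h h' h
  rw [chartChange_self I e h] at h1
  have h2 := congrArg ContinuousLinearMap.det h1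
  have h3 : ((chartChange I e' e p).comp (chartChange I e e' p)).det =
      (chartChange I e' e p).det * (chartChange I e e' p).det := by
    simp [ContinuousLinearMap.det, ContinuousLinearMap.toLinearMap_comp, LinearMap.det_comp]
  rw [h3] at h2
  intro h0
  rw [h0] at h2
  simp [ContinuousLinearMap.det] at h2

theorem transport_chartChange (e e' e'' : atlas H M) {p : M} (h : p ∈ e.1.source)
    (h' : p ∈ e'.1.source) (h'' : p ∈ e''.1.source)
    (o : Orientation ℝ (EuclideanSpace ℝ (Fin n)) (Fin n)) :
    transportOrientation (chartChange I e' e'' p) (transportOrientation (chartChange I e e' p) o) =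
      transportOrientation (chartChange I e e'' p) o := by
  rw [transportOrientation_comp (chartChange_det_ne_zero I e e' h h')
    (chartChange_det_ne_zero I e' e'' h' h''), chartChange_comp I e e' e'' h h' h'']

theorem transport_chartChange_self (e : atlas H M) {p : M} (h : p ∈ e.1.source)
    (o : Orientation ℝ (EuclideanSpace ℝ (Fin n)) (Fin n)) :
    transportOrientation (chartChange I e e p) o = o := by
  rw [chartChange_self I e h]
  simp [transportOrientation, ContinuousLinearMap.det]

/-- For a chart `(U, φ) = e` of `M` and an orientation `o` of `ℝⁿ` (there are two of them), the
chart `φ ∘ π` of the orientation double cover, on the set of all `(p, oₚ)` with `p ∈ U` such that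
the differential of `φ` carries `oₚ` to `o`. -/
def sheetChart (e : atlas H M) (o : Orientation ℝ (EuclideanSpace ℝ (Fin n)) (Fin n)) :
    PartialEquiv (OrientationCover I M) H where
  toFun q := e.1 q.point
  invFun h := ⟨e.1.symm h,
    transportOrientation (chartChange I e (achart H (e.1.symm h)) (e.1.symm h)) o⟩
  source := {q | q.point ∈ e.1.source ∧
    transportOrientation (chartChange I (achart H q.point) e q.point) q.orientation = o}
  target := e.1.target
  map_source' q hq := e.1.map_source hq.1
  map_target' h hh := by
    have hs := e.1.map_target hh
    refine ⟨hs, ?_⟩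
    change transportOrientation _ (transportOrientation _ o) = o
    rw [transport_chartChange I e (achart H _) e hs (mem_chart_source H _) hs,
      transport_chartChange_self I e hs]
  left_inv' := by
    rintro ⟨p, o'⟩ ⟨hp, ho⟩
    change p ∈ e.1.source at hp
    change transportOrientation (chartChange I (achart H p) e p) o' = o at ho
    have key : transportOrientation (chartChange I e (achart H p) p) o = o' := by
      rw [← ho]
      exact (transport_chartChange I (achart H p) e (achart H p) (mem_chart_source H p) hp
        (mem_chart_source H p) o').trans
          (transport_chartChange_self I (achart H p) (mem_chart_source H p) o')
    have aux : ∀ r : M, r = p →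
        (⟨r, transportOrientation (chartChange I e (achart H r) r) o⟩ : OrientationCover I M) =
          ⟨p, o'⟩ := by
      rintro r rfl
      exact congrArg (OrientationCover.mk (I := I) r) key
    exact aux _ (e.1.left_inv hp)
  right_inv' h hh := e.1.right_inv hh

theorem sheetChart_trans_source (e e' : atlas H M)
    (o o' : Orientation ℝ (EuclideanSpace ℝ (Fin n)) (Fin n)) :
    ((sheetChart I e o).symm.trans (sheetChart I e' o')).source =
      {h | h ∈ (e.1.symm.trans e'.1).source ∧
        transportOrientation (chartChange I e e' (e.1.symm h)) o = o'} := by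
  ext h
  constructor
  · rintro ⟨h1, h2, h3⟩
    change h ∈ e.1.target at h1
    change e.1.symm h ∈ e'.1.source at h2
    have hs := e.1.map_target h1
    refine ⟨by simpa using ⟨h1, h2⟩, ?_⟩
    rw [← h3]
    exact (transport_chartChange I e (achart H _) e' hs (mem_chart_source H _) h2 o).symm
  · rintro ⟨h1, h3⟩
    have h12 : h ∈ e.1.target ∧ e.1.symm h ∈ e'.1.source := by simpa using h1
    obtain ⟨h1, h2⟩ := h12
    have hs := e.1.map_target h1
    refine ⟨h1, h2, ?_⟩
    rw [← h3]
    exact transport_chartChange I e (achart H _) e' hs (mem_chart_source H _) h2 o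

theorem isOpen_sheetChart_trans_source (e e' : atlas H M)
    (o o' : Orientation ℝ (EuclideanSpace ℝ (Fin n)) (Fin n)) :
    IsOpen ((sheetChart I e o).symm.trans (sheetChart I e' o')).source := by
  rw [sheetChart_trans_source]
  have hO : IsOpen (e.1.symm.trans e'.1).source := (e.1.symm.trans e'.1).open_source
  have hmaps : ∀ h ∈ (e.1.symm.trans e'.1).source,
      h ∈ e.1.target ∧ e.1.symm h ∈ e'.1.source := fun h hh => by simpa using hh
  have hc : ContinuousOn (fun h => (chartChange I e e' (e.1.symm h)).det)
      (e.1.symm.trans e'.1).source := by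
    refine ContinuousLinearMap.continuous_det.comp_continuousOn
      (((tangentBundleCore I M).continuousOn_coordChange e e').comp
        (e.1.continuousOn_symm.mono fun h hh => (hmaps h hh).1) fun h hh => ?_)
    exact ⟨e.1.map_target (hmaps h hh).1, (hmaps h hh).2⟩
  have hne : ∀ h ∈ (e.1.symm.trans e'.1).source, (chartChange I e e' (e.1.symm h)).det ≠ 0 :=
    fun h hh => chartChange_det_ne_zero I e e' (e.1.map_target (hmaps h hh).1) (hmaps h hh).2
  rw [isOpen_iff_mem_nhds]
  rintro h ⟨hh, ho⟩
  have hat := hc.continuousAt (hO.mem_nhds hh)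
  rcases lt_or_gt_of_ne (hne h hh) with hd | hd
  · filter_upwards [hO.mem_nhds hh, hat.eventually_lt continuousAt_const hd] with k hk hkd
    refine ⟨hk, ?_⟩
    rw [← ho]
    simp [transportOrientation, hd.not_gt, hkd.not_gt]
  · filter_upwards [hO.mem_nhds hh, continuousAt_const.eventually_lt hat hd] with k hk hkd
    refine ⟨hk, ?_⟩
    rw [← ho]
    simp [transportOrientation, hd, hkd]

variable (M)

/-- The smooth atlas (and with it the topology) of the standard orientation double cover, made of
the charts `sheetChart e o`, for all charts `e` of `M` and both orientations `o` of `ℝⁿ`. -/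
def orientationCoverCore : ChartedSpaceCore H (OrientationCover I M) where
  atlas := {c | ∃ (e : atlas H M) (o : Orientation ℝ (EuclideanSpace ℝ (Fin n)) (Fin n)),
    c = sheetChart I e o}
  chartAt q := sheetChart I (achart H q.point) q.orientation
  mem_chart_source q := ⟨mem_chart_source H q.point,
    transport_chartChange_self I _ (mem_chart_source H q.point) _⟩
  chart_mem_atlas q := ⟨achart H q.point, q.orientation, rfl⟩
  open_source := by
    rintro _ _ ⟨e, o, rfl⟩ ⟨e', o', rfl⟩
    exact isOpen_sheetChart_trans_source I e e' o o'
  continuousOn_toFun := by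
    rintro _ _ ⟨e, o, rfl⟩ ⟨e', o', rfl⟩
    have h : ContinuousOn (e.1.symm.trans e'.1) (e.1.symm.trans e'.1).source :=
      (e.1.symm.trans e'.1).continuousOn
    refine h.mono ?_
    rw [sheetChart_trans_source]
    exact fun k hk => hk.1

instance : TopologicalSpace (OrientationCover I M) :=
  (orientationCoverCore I M).toTopologicalSpace

instance : ChartedSpace H (OrientationCover I M) :=
  (orientationCoverCore I M).toChartedSpace

end Cover

/-! ### Model surfaces -/

/-- A polynomial in two variables which is positive inside the disc of radius `2g + 1` about the
origin with the `g` closed unit discs about the points `(4i - 2(g - 1), 0)`, `0 ≤ i < g`, removed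
(these unit discs are disjoint and inside the large disc), negative off the closure of this
region, and which has `0` as a regular value. It is even: `h (-x) (-y) = h x y`. -/
def holedDisc (g : ℕ) (x y : ℝ) : ℝ :=
  ((2 * g + 1) ^ 2 - x ^ 2 - y ^ 2) *
    ∏ i ∈ Finset.range g, ((x - (4 * i - 2 * (g - 1))) ^ 2 + y ^ 2 - 1)

/-- The closed connected orientable surface `Σ_g` of genus `g`, as the smooth regular level set
`z² = h(x, y)` in `ℝ³`: two copies of a disc with `g` holes glued along their boundaries. It is
invariant under the antipodal map `p ↦ -p` of `ℝ³`, which has no fixed point on it. -/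
def orientableSurface (g : ℕ) : Set (EuclideanSpace ℝ (Fin 3)) :=
  {p | p 2 ^ 2 = holedDisc g (p 0) (p 1)}

/-- The map `p ↦ p pᵀ`. It is an immersion off the origin, and identifies exactly `p` with `-p`;
so it embeds the quotient of `ℝ³ ∖ {0}` by the antipodal map. -/
def antipodalQuotient (p : EuclideanSpace ℝ (Fin 3)) : Fin 3 → Fin 3 → ℝ :=
  fun i j => p i * p j

/-- The closed connected non-orientable surface `N_g` of genus `g ≥ 1` (the connected sum of `g`
projective planes), as the quotient of `Σ_{g-1}` by the antipodal map, embedded in the space of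
`3 × 3` matrices. A fundamental domain is the half `z ≥ 0`, a disc with `g - 1` holes; its outer
boundary circle and, if `g` is even, that of the central hole are closed up by their antipodal
maps, which amounts to gluing in Möbius bands (cross caps), and the other holes are joined in
pairs by handles. So for `g = 2k + 1` this is a closed surface with one cross cap and `k` handles,
and for `g = 2k + 2` one with two cross caps and `k` handles. -/
def nonorientableSurface (g : ℕ) : Set (Fin 3 → Fin 3 → ℝ) :=
  antipodalQuotient '' orientableSurface (g - 1)

/-- Two subsets of manifolds are diffeomorphic if there are mutually inverse smooth bijections
between them, where a map on a subset is smooth if it is smooth as a map into the ambient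
manifold (it has local smooth extensions, to every finite order). For embedded submanifolds this
is the usual notion. -/
def AreDiffeomorphic {E F H K M N : Type*} [NormedAddCommGroup E] [NormedSpace ℝ E]
    [NormedAddCommGroup F] [NormedSpace ℝ F] [TopologicalSpace H] [TopologicalSpace K]
    (I : ModelWithCorners ℝ E H) (J : ModelWithCorners ℝ F K)
    [TopologicalSpace M] [ChartedSpace H M] [TopologicalSpace N] [ChartedSpace K N]
    (A : Set M) (B : Set N) : Prop :=
  ∃ (φ : M → N) (ψ : N → M), ContMDiffOn I J ∞ φ A ∧ ContMDiffOn J I ∞ ψ B ∧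
    MapsTo φ A B ∧ MapsTo ψ B A ∧ LeftInvOn ψ φ A ∧ RightInvOn ψ φ B

/-! ### Lefschetz fibrations -/

/-- The critical points of a map between manifolds: the points where the differential is not
surjective. -/
def criticalPoints {E F H K M N : Type*} [NormedAddCommGroup E] [NormedSpace ℝ E]
    [NormedAddCommGroup F] [NormedSpace ℝ F] [TopologicalSpace H] [TopologicalSpace K]
    (I : ModelWithCorners ℝ E H) (J : ModelWithCorners ℝ F K)
    [TopologicalSpace M] [ChartedSpace H M] [TopologicalSpace N] [ChartedSpace K N]
    (f : M → N) : Set M :=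
  {x | ¬ Function.Surjective (mfderiv I J f x)}

/-- `e` is a smooth coordinate chart of `M` with values in the real vector space `F`, that is, a
diffeomorphism of an open subset of `M` onto an open subset of `F`. -/
def IsSmoothChart {E F H M : Type*} [NormedAddCommGroup E] [NormedSpace ℝ E]
    [NormedAddCommGroup F] [NormedSpace ℝ F] [TopologicalSpace H]
    (I : ModelWithCorners ℝ E H) [TopologicalSpace M] [ChartedSpace H M]
    (e : OpenPartialHomeomorph M F) : Prop :=
  ContMDiffOn I 𝓘(ℝ, F) ∞ e e.source ∧ ContMDiffOn 𝓘(ℝ, F) I ∞ e.symm e.target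

/-- Compact connected (Hausdorff) smooth manifolds, possibly with boundary. -/
structure IsCompactConnectedManifold {E H : Type*} [NormedAddCommGroup E] [NormedSpace ℝ E]
    [TopologicalSpace H] (I : ModelWithCorners ℝ E H)
    (M : Type*) [TopologicalSpace M] [ChartedSpace H M] : Prop where
  t2 : T2Space M
  compact : CompactSpace M
  connected : ConnectedSpace M
  smooth : IsManifold I ∞ M

section Lefschetz

variable {X S : Type*} [TopologicalSpace X] [ChartedSpace (EuclideanHalfSpace 4) X]
  [TopologicalSpace S] [ChartedSpace (EuclideanHalfSpace 2) S]

/-- `φ` and `ψ` are complex coordinate charts of `X` about `x` and of `S` about `f x`, in which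
`f` is the map `(z, w) ↦ z w`. -/
structure IsLefschetzChartPair (f : X → S) (x : X) (φ : OpenPartialHomeomorph X (ℂ × ℂ))
    (ψ : OpenPartialHomeomorph S ℂ) : Prop where
  smooth_total : IsSmoothChart (𝓡∂ 4) φ
  smooth_base : IsSmoothChart (𝓡∂ 2) ψ
  mem_total : x ∈ φ.source
  mapsTo : MapsTo f φ.source ψ.source
  eq_mul : ∀ p ∈ φ.source, ψ (f p) = (φ p).1 * (φ p).2

/-- Lefschetz fibrations. -/
structure IsLefschetzFibration (f : X → S) : Prop where
  total : IsCompactConnectedManifold (𝓡∂ 4) X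
  base : IsCompactConnectedManifold (𝓡∂ 2) S
  base_orientable : IsOrientableManifold (𝓡∂ 2) S
  smooth : ContMDiff (𝓡∂ 4) (𝓡∂ 2) ∞ f
  boundary_eq : (𝓡∂ 4).boundary X = f ⁻¹' (𝓡∂ 2).boundary S
  critical_interior : criticalPoints (𝓡∂ 4) (𝓡∂ 2) f ⊆ (𝓡∂ 4).interior X
  critical_chart : ∀ x ∈ criticalPoints (𝓡∂ 4) (𝓡∂ 2) f,
    ∃ φ ψ, IsLefschetzChartPair f x φ ψ

/-- Non-orientable Lefschetz fibrations of genus `g`: the total space is not orientable, and the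
fibre over every point that is not a critical value is diffeomorphic to `N_g`. -/
structure IsNonorientableLefschetzFibration (f : X → S) (g : ℕ) : Prop where
  lefschetz : IsLefschetzFibration f
  total_nonorientable : ¬ IsOrientableManifold (𝓡∂ 4) X
  one_le_genus : 1 ≤ g
  regular_fiber : ∀ y ∉ f '' criticalPoints (𝓡∂ 4) (𝓡∂ 2) f,
    AreDiffeomorphic (𝓡∂ 4) 𝓘(ℝ, Fin 3 → Fin 3 → ℝ) (f ⁻¹' {y}) (nonorientableSurface g)

/-- Orientable Lefschetz fibrations of genus `g`: the total space is orientable, and the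
fibre over every point that is not a critical value is diffeomorphic to `Σ_g`. -/
structure IsOrientableLefschetzFibration (f : X → S) (g : ℕ) : Prop where
  lefschetz : IsLefschetzFibration f
  total_orientable : IsOrientableManifold (𝓡∂ 4) X
  regular_fiber : ∀ y ∉ f '' criticalPoints (𝓡∂ 4) (𝓡∂ 2) f,
    AreDiffeomorphic (𝓡∂ 4) 𝓘(ℝ, EuclideanSpace ℝ (Fin 3)) (f ⁻¹' {y}) (orientableSurface g)

/-- The basis `(1, 0), (i, 0), (0, 1), (0, i)` of `ℂ²` over `ℝ`. -/
def complexPlaneBasis : Module.Basis (Fin 4) ℝ (ℂ × ℂ) :=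
  (Complex.basisOneI.prod Complex.basisOneI).reindex finSumFinEquiv

/-- The complex orientation of `ℂ²`. -/
def complexPlaneOrientation : Orientation ℝ (ℂ × ℂ) (Fin 4) := complexPlaneBasis.orientation

/-- The chart `φ` of `X` carries the orientation `𝔬` of `X` to the orientation `o` of `ℂ²`. -/
def ChartMapsOrientation (𝔬 : ManifoldOrientation (𝓡∂ 4) X) (φ : OpenPartialHomeomorph X (ℂ × ℂ))
    (o : Orientation ℝ (ℂ × ℂ) (Fin 4)) : Prop :=
  ∀ p ∈ φ.source, MapsOrientation (differentialAt (𝓡∂ 4) φ p).toLinearMap (𝔬.at_point p) o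

/-- The positive critical points of a Lefschetz fibration with oriented total space: those about
which the chart of the total space in the local model can be taken orientation preserving. -/
def positiveCriticalPoints (𝔬 : ManifoldOrientation (𝓡∂ 4) X) (f : X → S) : Set X :=
  {x ∈ criticalPoints (𝓡∂ 4) (𝓡∂ 2) f | ∃ φ ψ, IsLefschetzChartPair f x φ ψ ∧
    ChartMapsOrientation 𝔬 φ complexPlaneOrientation}

/-- The negative critical points of a Lefschetz fibration with oriented total space: those about
which the chart of the total space in the local model can be taken orientation reversing. -/
def negativeCriticalPoints (𝔬 : ManifoldOrientation (𝓡∂ 4) X) (f : X → S) : Set X :=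
  {x ∈ criticalPoints (𝓡∂ 4) (𝓡∂ 2) f | ∃ φ ψ, IsLefschetzChartPair f x φ ψ ∧
    ChartMapsOrientation 𝔬 φ (-complexPlaneOrientation)}

/-- A Lefschetz fibration with oriented total space is achiral, in the strict sense, if some
critical point has an orientation reversing chart of the local model. -/
def IsAchiral (𝔬 : ManifoldOrientation (𝓡∂ 4) X) (f : X → S) : Prop :=
  (negativeCriticalPoints 𝔬 f).Nonempty

end Lefschetz

end

noncomputable section

/-! ### The orientation double cover as a manifold -/

namespace OrientationCover

/-! The projection `π` of the orientation cover is a local diffeomorphism, and the cover has a free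
deck involution over `X` which reverses the orientation. A tangent space is the model space read in
the preferred chart, and the preferred chart of the cover at `q` is that of the base at `q.point`
composed with `π`. So `π` and the deck map have the identity as differential (`hasMFDerivAt_proj`,
`hasMFDerivAt_deck`). Critical points, boundary and local models of `f` therefore lift to `f ∘ π`
unchanged.

The cover carries a tautological orientation. It is connected (`connectedSpace`), since a nontrivial
clopen set would be the image of a continuous section of `π`, that is, an orientation of `X`. Hence
an orientation of the cover is the tautological one or its negative everywhere, and the deck map
reverses it (`at_point_deck`). Composing a Lefschetz chart with the deck map thus exchanges positive
and negative critical points, which gives the equal counts and achirality. Finiteness is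
compactness: the model `zw` is critical only at the origin, and the regular points form an open set.

The long part is the regular fibre. A fibre of `f` is `Σ_{g-1}` modulo the antipodal map, and its
preimage under `π` has to be identified with `Σ_{g-1}`. A point `p` of the surface orients the
tangent space of `X` at its image `x`: the differential of `f` handles the directions across the
fibre, and the gradient of the defining function at `p` orients the fibre. In formulas, the sign is
that of the determinant of `(v, t) ↦ (A v, B v + t z)` from `ℝ⁴ × ℝ` to `ℝ² × ℝ³` (`frameDet`),
where `A` is the differential of `f` and `B`, `z` are the fibre derivative and the gradient, pushed
to `ℝ³` by contracting `3 × 3` matrices with `p`. Replacing `p` by `-p` negates `B` and `z`, and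
`-1` has determinant `-1` on `ℝ³`; so `-p` goes to the deck image of the lift of `p`
(`fiberLift_neg`). This makes `fiberLift` a bijection of `Σ_{g-1}` onto the fibre of `f ∘ π`. It is
continuous because the determinant is continuous and nonzero in a fixed chart
(`continuousOn_fiberLift`), hence smooth since `π` is a local diffeomorphism. Its inverse is smooth
because `p ↦ p pᵀ` has smooth local sections (`contMDiffOn_of_fiberLift_rightInverse`). -/

theorem model_orientation_eq_or {n : ℕ}
    (o o' : Orientation ℝ (EuclideanSpace ℝ (Fin n)) (Fin n)) : o = o' ∨ o = -o' :=
  o.eq_or_eq_neg o' (by simp)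

theorem model_orientation_ne_neg {n : ℕ}
    (o : Orientation ℝ (EuclideanSpace ℝ (Fin n)) (Fin n)) : o ≠ -o :=
  Module.Ray.ne_neg_self o

theorem transportOrientation_neg {n : ℕ}
    (A : EuclideanSpace ℝ (Fin n) →L[ℝ] EuclideanSpace ℝ (Fin n))
    (o : Orientation ℝ (EuclideanSpace ℝ (Fin n)) (Fin n)) :
    transportOrientation A (-o) = -transportOrientation A o := by
  unfold transportOrientation
  split_ifs <;> rfl

variable {n : ℕ} {H : Type*} [TopologicalSpace H]
  {I : ModelWithCorners ℝ (EuclideanSpace ℝ (Fin n)) H}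
  {M : Type*} [TopologicalSpace M] [ChartedSpace H M]

/-- The orientation of the model space given by a point of the orientation cover, through the
preferred chart. -/
def modelOrientation (q : OrientationCover I M) :
    Orientation ℝ (EuclideanSpace ℝ (Fin n)) (Fin n) := q.orientation

/-- The deck transformation of the orientation double cover, reversing the orientation. -/
def deck (q : OrientationCover I M) : OrientationCover I M := ⟨q.point, -q.orientation⟩

@[simp] theorem deck_deck (q : OrientationCover I M) : deck (deck q) = q := by
  rcases q with ⟨x, o⟩
  exact congrArg (OrientationCover.mk (I := I) x) (neg_neg o)

theorem eq_or_eq_deck {q q' : OrientationCover I M} (h : proj I M q = proj I M q') :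
    q = q' ∨ q = deck q' := by
  rcases q with ⟨x, o⟩
  rcases q' with ⟨x', o'⟩
  change x = x' at h
  subst h
  rcases model_orientation_eq_or o o' with h | h
  · exact Or.inl (congrArg (OrientationCover.mk (I := I) x) h)
  · exact Or.inr (congrArg (OrientationCover.mk (I := I) x) h)

theorem mk_eq_iff {x : M} {o o' : Orientation ℝ (EuclideanSpace ℝ (Fin n)) (Fin n)} :
    (⟨x, o⟩ : OrientationCover I M) = ⟨x, o'⟩ ↔ o = o' := by
  constructor
  · intro h
    injection h
  · rintro rfl; rfl

theorem deck_ne (q : OrientationCover I M) : deck q ≠ q := by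
  rcases q with ⟨x, o⟩
  intro h
  exact model_orientation_ne_neg o (mk_eq_iff.1 h).symm

variable [IsManifold I 1 M]

/-- The sheet charts as homeomorphisms. -/
def sheet (e : atlas H M) (o : Orientation ℝ (EuclideanSpace ℝ (Fin n)) (Fin n)) :
    OpenPartialHomeomorph (OrientationCover I M) H :=
  (orientationCoverCore I M).openPartialHomeomorph (sheetChart I e o) ⟨e, o, rfl⟩

theorem mem_sheet_source {e : atlas H M} {o : Orientation ℝ (EuclideanSpace ℝ (Fin n)) (Fin n)}
    {q : OrientationCover I M} : q ∈ (sheet e o).source ↔ q.point ∈ e.1.source ∧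
      transportOrientation (chartChange I (achart H q.point) e q.point) q.modelOrientation = o :=
  Iff.rfl

theorem chartAt_eq_sheet (q : OrientationCover I M) :
    chartAt H q = sheet (achart H q.point) q.modelOrientation := rfl

theorem mem_atlas_iff {c : OpenPartialHomeomorph (OrientationCover I M) H} :
    c ∈ atlas H (OrientationCover I M) ↔ ∃ e o, c = sheet e o := by
  constructor
  · intro h
    obtain ⟨c', hc', h'⟩ := mem_iUnion₂.1 h
    obtain ⟨e, o, rfl⟩ := hc'
    exact ⟨e, o, h'⟩
  · rintro ⟨e, o, rfl⟩
    exact mem_iUnion₂.2 ⟨sheetChart I e o, ⟨e, o, rfl⟩, rfl⟩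

/-- The projection of the orientation cover, as a homeomorphism of a sheet onto the domain of a
chart of the base. -/
def localProj (e : atlas H M) (o : Orientation ℝ (EuclideanSpace ℝ (Fin n)) (Fin n)) :
    OpenPartialHomeomorph (OrientationCover I M) M :=
  (sheet e o).trans e.1.symm

theorem localProj_source (e : atlas H M) (o : Orientation ℝ (EuclideanSpace ℝ (Fin n)) (Fin n)) :
    (localProj (I := I) e o).source = (sheet e o).source := by
  ext q
  simp only [localProj, OpenPartialHomeomorph.trans_source, mem_inter_iff, mem_preimage,
    OpenPartialHomeomorph.symm_source]
  exact ⟨fun h => h.1, fun h => ⟨h, (sheet e o).map_source h⟩⟩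

theorem localProj_target (e : atlas H M) (o : Orientation ℝ (EuclideanSpace ℝ (Fin n)) (Fin n)) :
    (localProj (I := I) e o).target = e.1.source := by
  ext q
  simp only [localProj, OpenPartialHomeomorph.trans_target, mem_inter_iff, mem_preimage,
    OpenPartialHomeomorph.symm_target, OpenPartialHomeomorph.symm_symm]
  exact ⟨fun h => h.1, fun h => ⟨h, e.1.map_source h⟩⟩

theorem localProj_apply {e : atlas H M}
    {o : Orientation ℝ (EuclideanSpace ℝ (Fin n)) (Fin n)} {q : OrientationCover I M}
    (hq : q ∈ (sheet e o).source) : localProj e o q = proj I M q :=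
  e.1.left_inv hq.1

theorem proj_localProj_symm {e : atlas H M}
    {o : Orientation ℝ (EuclideanSpace ℝ (Fin n)) (Fin n)} {x : M}
    (hx : x ∈ e.1.source) : proj I M ((localProj e o).symm x) = x := by
  have h : x ∈ (localProj (I := I) e o).target := by rwa [localProj_target]
  have h1 := (localProj (I := I) e o).map_target h
  rw [localProj_source] at h1
  rw [← localProj_apply h1]
  exact (localProj (I := I) e o).right_inv h

theorem mem_sheet_source_self (q : OrientationCover I M) :
    q ∈ (sheet (achart H q.point) q.modelOrientation).source :=
  mem_chart_source H q

theorem exists_mem_sheet_source {e : atlas H M} {q : OrientationCover I M}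
    (h : q.point ∈ e.1.source) : ∃ o, q ∈ (sheet e o).source := ⟨_, h, rfl⟩

theorem sheet_source_inter_neg (e : atlas H M)
    (o : Orientation ℝ (EuclideanSpace ℝ (Fin n)) (Fin n)) :
    Disjoint (sheet (I := I) e o).source (sheet e (-o)).source := by
  rw [Set.disjoint_left]
  rintro q ⟨-, h⟩ ⟨-, h'⟩
  exact model_orientation_ne_neg o (h.symm.trans h')

theorem deck_mem_sheet_source {e : atlas H M}
    {o : Orientation ℝ (EuclideanSpace ℝ (Fin n)) (Fin n)} {q : OrientationCover I M} :
    deck q ∈ (sheet e (-o)).source ↔ q ∈ (sheet e o).source := by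
  rw [mem_sheet_source, mem_sheet_source]
  refine and_congr Iff.rfl ?_
  change transportOrientation _ (-q.modelOrientation) = -o ↔ _
  have := transportOrientation_neg (chartChange I (achart H q.point) e q.point) q.modelOrientation
  constructor
  · intro h
    have h2 := this.symm.trans h
    exact neg_inj.1 h2
  · intro h
    exact this.trans (congrArg _ h)

theorem continuous_proj : Continuous (proj I M) := by
  rw [continuous_iff_continuousAt]
  intro q
  have hq := mem_sheet_source_self q
  have h : ContinuousAt (localProj (achart H q.point) q.modelOrientation) q :=
    (localProj _ _).continuousAt (by rwa [localProj_source])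
  refine h.congr ?_
  filter_upwards [(sheet (I := I) (achart H q.point) q.modelOrientation).open_source.mem_nhds hq]
    with r hr using localProj_apply hr

/-- A map into the orientation cover is continuous at a point if it is so after projection, and
stays in a sheet. -/
theorem continuousWithinAt_of_proj {Y : Type*} [TopologicalSpace Y] {s : Set Y} {y : Y}
    {u : Y → OrientationCover I M} {e : atlas H M}
    {o : Orientation ℝ (EuclideanSpace ℝ (Fin n)) (Fin n)} (hys : y ∈ s)
    (h : ContinuousWithinAt (proj I M ∘ u) s y)
    (hu : ∀ᶠ z in 𝓝[s] y, u z ∈ (sheet e o).source) : ContinuousWithinAt u s y := by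
  have hy : u y ∈ (sheet e o).source := hu.self_of_nhdsWithin hys
  have hc : ContinuousAt (localProj (I := I) e o).symm ((proj I M ∘ u) y) :=
    (localProj (I := I) e o).continuousAt_symm (by rw [localProj_target]; exact hy.1)
  have h1 := hc.comp_continuousWithinAt h
  have key : ∀ z, u z ∈ (sheet e o).source →
      (localProj (I := I) e o).symm (proj I M (u z)) = u z := fun z hz => by
    rw [← localProj_apply hz]
    exact (localProj (I := I) e o).left_inv (by rwa [localProj_source])
  refine h1.congr_of_eventuallyEq ?_ (key y hy).symm
  filter_upwards [hu] with z hz using (key z hz).symm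

theorem continuous_deck : Continuous (deck : OrientationCover I M → OrientationCover I M) := by
  rw [continuous_iff_continuousAt]
  intro q
  rw [← continuousWithinAt_univ]
  refine continuousWithinAt_of_proj (e := achart H q.point) (o := -q.modelOrientation) (mem_univ _)
    (continuous_proj.continuousWithinAt) ?_
  rw [nhdsWithin_univ]
  filter_upwards [(sheet (I := I) (achart H q.point) q.modelOrientation).open_source.mem_nhds
    (mem_sheet_source_self q)] with r hr using deck_mem_sheet_source.2 hr

/-- The deck transformation as a homeomorphism. -/
def deckHomeomorph : OrientationCover I M ≃ₜ OrientationCover I M where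
  toFun := deck
  invFun := deck
  left_inv := deck_deck
  right_inv := deck_deck
  continuous_toFun := continuous_deck
  continuous_invFun := continuous_deck

theorem isOpenMap_proj : IsOpenMap (proj I M) := by
  rw [isOpenMap_iff_nhds_le]
  intro q
  have hq := mem_sheet_source_self q
  have hs : q ∈ (localProj (I := I) (achart H q.point) q.modelOrientation).source := by
    rwa [localProj_source]
  have h := (localProj (I := I) (achart H q.point) q.modelOrientation).map_nhds_eq hs
  rw [localProj_apply hq] at h
  rw [← h]
  refine le_of_eq (Filter.map_congr ?_)
  filter_upwards [(sheet (I := I) (achart H q.point) q.modelOrientation).open_source.mem_nhds hq]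
    with r hr using localProj_apply hr

/-- Distinct points over the same base point are exchanged by the deck map, and the two opposite
sheets over a chart separate them. -/
instance [T2Space M] : T2Space (OrientationCover I M) := by
  refine ⟨fun q q' hne => ?_⟩
  by_cases h : proj I M q = proj I M q'
  · rcases eq_or_eq_deck h with h' | h'
    · exact absurd h' hne
    · refine ⟨(sheet (achart H q'.point) (-q'.modelOrientation)).source,
        (sheet (achart H q'.point) q'.modelOrientation).source,
        (sheet (I := I) _ _).open_source, (sheet (I := I) _ _).open_source, ?_,
        mem_sheet_source_self q', (sheet_source_inter_neg _ _).symm⟩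
      rw [h']
      exact deck_mem_sheet_source.2 (mem_sheet_source_self q')
  · exact separated_by_continuous continuous_proj h

/-- Over the domain of one chart the preimage consists of two copies of `K`, one in each sheet. -/
theorem isCompact_proj_preimage {e : atlas H M} {K : Set M} (hK : IsCompact K)
    (hKe : K ⊆ e.1.source) : IsCompact (proj I M ⁻¹' K) := by
  let o : Orientation ℝ (EuclideanSpace ℝ (Fin n)) (Fin n) :=
    (EuclideanSpace.basisFun (Fin n) ℝ).toBasis.orientation
  have h (o' : Orientation ℝ (EuclideanSpace ℝ (Fin n)) (Fin n)) :
      IsCompact ((localProj (I := I) e o').symm '' K) :=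
    hK.image_of_continuousOn ((localProj (I := I) e o').continuousOn_symm.mono
      (by rwa [localProj_target]))
  have hsub : proj I M ⁻¹' K =
      (localProj (I := I) e o).symm '' K ∪ (localProj (I := I) e (-o)).symm '' K := by
    have key : ∀ (q : OrientationCover I M) (o' : _), q ∈ (sheet e o').source →
        (localProj (I := I) e o').symm (proj I M q) = q := fun q o' hz => by
      rw [← localProj_apply hz]
      exact (localProj (I := I) e o').left_inv (by rwa [localProj_source])
    ext q
    constructor
    · intro hq
      obtain ⟨o', ho'⟩ := exists_mem_sheet_source (hKe hq)
      rcases model_orientation_eq_or o' o with rfl | rfl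
      · exact Or.inl ⟨_, hq, key q _ ho'⟩
      · exact Or.inr ⟨_, hq, key q _ ho'⟩
    · rintro (⟨x, hx, rfl⟩ | ⟨x, hx, rfl⟩) <;>
      · rw [mem_preimage, proj_localProj_symm (hKe hx)]
        exact hx
  rw [hsub]
  exact (h o).union (h (-o))

theorem compactSpace [T2Space M] [CompactSpace M] : CompactSpace (OrientationCover I M) := by
  have hK (x : M) : ∃ K ∈ 𝓝 x, K ⊆ (achart H x).1.source ∧ IsCompact K :=
    local_compact_nhds ((chartAt H x).open_source.mem_nhds (mem_chart_source H x))
  choose K hK hKs hKc using hK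
  obtain ⟨t, ht⟩ := CompactSpace.elim_nhds_subcover K hK
  refine ⟨?_⟩
  have : (univ : Set (OrientationCover I M)) = ⋃ x ∈ t, proj I M ⁻¹' K x := by
    rw [← preimage_iUnion₂, ht]
    rfl
  rw [this]
  exact t.isCompact_biUnion fun x _ => isCompact_proj_preimage (hKc x) (hKs x)

/-- The transition maps between sheets are restrictions of transition maps of `M`. -/
theorem isManifold {m : ℕ∞ω} [IsManifold I m M] : IsManifold I m (OrientationCover I M) := by
  refine isManifold_of_contDiffOn I m _ fun c c' hc hc' => ?_
  obtain ⟨e, o, rfl⟩ := mem_atlas_iff.1 hc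
  obtain ⟨e', o', rfl⟩ := mem_atlas_iff.1 hc'
  have h := ((contDiffGroupoid m I).compatible e.2 e'.2 :
    e.1.symm ≫ₕ e'.1 ∈ contDiffGroupoid m I)
  have h1 := (contDiffGroupoid m I).mem_of_eqOnSource h (OpenPartialHomeomorph.eqOnSource_refl _)
  rw [contDiffGroupoid, mem_groupoid_of_pregroupoid] at h1
  refine h1.1.mono ?_
  refine inter_subset_inter_left _ (preimage_mono ?_)
  intro k hk
  have hk' : k ∈ ((sheetChart I e o).symm.trans (sheetChart I e' o')).source := hk
  rw [sheetChart_trans_source] at hk'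
  exact hk'.1

end OrientationCover
end

noncomputable section

/-! ### Orientations in charts -/

/-- Links the isomorphism form used in `ManifoldOrientation` to the determinant form in which the
sheets are built. -/
theorem mapsOrientation_iff_transportOrientation {n : ℕ}
    {A : EuclideanSpace ℝ (Fin n) →L[ℝ] EuclideanSpace ℝ (Fin n)} (hA : A.det ≠ 0)
    {o o' : Orientation ℝ (EuclideanSpace ℝ (Fin n)) (Fin n)} :
    MapsOrientation A.toLinearMap o o' ↔ transportOrientation A o = o' := by
  have h : ((A.toContinuousLinearEquivOfDetNeZero hA : EuclideanSpace ℝ (Fin n) ≃L[ℝ] _) :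
      EuclideanSpace ℝ (Fin n) →L[ℝ] EuclideanSpace ℝ (Fin n)) = A := by
    ext1 v; rfl
  have h2 := transportOrientation_eq_map (A.toContinuousLinearEquivOfDetNeZero hA) o
  rw [h] at h2
  rw [h2]
  constructor
  · rintro ⟨L, hL, rfl⟩
    refine congrArg (fun K => Orientation.map (Fin n) K o) ?_
    ext1 v
    exact (DFunLike.congr_fun hL v).symm
  · intro h3
    exact ⟨_, LinearMap.ext fun v => rfl, h3⟩

theorem transportOrientation_inj {n : ℕ}
    {A : EuclideanSpace ℝ (Fin n) →L[ℝ] EuclideanSpace ℝ (Fin n)}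
    {o o' : Orientation ℝ (EuclideanSpace ℝ (Fin n)) (Fin n)} :
    transportOrientation A o = transportOrientation A o' ↔ o = o' := by
  unfold transportOrientation
  split_ifs
  · exact Iff.rfl
  · exact neg_inj (a := o) (b := o')

/-- Differentials carry at most one orientation to a given one. -/
theorem MapsOrientation.unique {V W : Type*} [AddCommGroup V] [Module ℝ V] [AddCommGroup W]
    [Module ℝ W] {n : ℕ} {A : V →ₗ[ℝ] W} {o : Orientation ℝ V (Fin n)}
    {o₁ o₂ : Orientation ℝ W (Fin n)} (h₁ : MapsOrientation A o o₁) (h₂ : MapsOrientation A o o₂) :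
    o₁ = o₂ := by
  obtain ⟨L, hL, rfl⟩ := h₁
  obtain ⟨L', hL', rfl⟩ := h₂
  rw [LinearEquiv.toLinearMap_injective (hL.trans hL'.symm)]

theorem MapsOrientation.neg {V W : Type*} [AddCommGroup V] [Module ℝ V] [AddCommGroup W]
    [Module ℝ W] {n : ℕ} {A : V →ₗ[ℝ] W} {o : Orientation ℝ V (Fin n)}
    {o' : Orientation ℝ W (Fin n)} (h : MapsOrientation A o o') : MapsOrientation A (-o) (-o') := by
  obtain ⟨L, hL, rfl⟩ := h
  exact ⟨L, hL, Orientation.map_neg L o⟩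

section

variable {n : ℕ} {H : Type*} [TopologicalSpace H]
  {I : ModelWithCorners ℝ (EuclideanSpace ℝ (Fin n)) H}
  {M : Type*} [TopologicalSpace M] [ChartedSpace H M] [IsManifold I 1 M]

/-- The tangent space at `r` is read in the preferred chart at `r`, so differentiating the chart at
`p` gives the derivative of a transition map. -/
theorem differentialAt_extChartAt {p r : M} (hr : r ∈ (chartAt H p).source) :
    differentialAt I (extChartAt I p) r = chartChange I (achart H r) (achart H p) r := by
  have h : MDifferentiableAt I 𝓘(ℝ, EuclideanSpace ℝ (Fin n)) (extChartAt I p) r :=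
    mdifferentiableAt_extChartAt hr
  unfold differentialAt
  refine h.mfderiv.trans ?_
  exact (tangentBundleCore_coordChange_achart r p r).symm

theorem hasMFDerivAt_extChartAt_chartChange {p r : M} (hr : r ∈ (chartAt H p).source) :
    HasMFDerivAt I 𝓘(ℝ, EuclideanSpace ℝ (Fin n)) (extChartAt I p) r
      (chartChange I (achart H r) (achart H p) r) := by
  have h : MDifferentiableAt I 𝓘(ℝ, EuclideanSpace ℝ (Fin n)) (extChartAt I p) r :=
    mdifferentiableAt_extChartAt hr
  have h2 := h.hasMFDerivAt
  rwa [show mfderiv I 𝓘(ℝ, EuclideanSpace ℝ (Fin n)) (extChartAt I p) r =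
    chartChange I (achart H r) (achart H p) r from differentialAt_extChartAt hr] at h2

theorem mapsOrientation_extChartAt_iff {p r : M} (hr : r ∈ (chartAt H p).source)
    {o o' : Orientation ℝ (EuclideanSpace ℝ (Fin n)) (Fin n)} :
    MapsOrientation (differentialAt I (extChartAt I p) r).toLinearMap o o' ↔
      transportOrientation (chartChange I (achart H r) (achart H p) r) o = o' := by
  have h := mapsOrientation_iff_transportOrientation (o := o) (o' := o')
    (chartChange_det_ne_zero I (achart H r) (achart H p) (mem_chart_source H r) hr)
  rw [← h, ← differentialAt_extChartAt hr]
  exact Iff.rfl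

namespace ManifoldOrientation

theorem eventually_transportOrientation (𝔬 : ManifoldOrientation I M) (p : M) :
    ∃ o : Orientation ℝ (EuclideanSpace ℝ (Fin n)) (Fin n), ∀ᶠ r in 𝓝 p,
      transportOrientation (chartChange I (achart H r) (achart H p) r) (𝔬.at_point r) = o := by
  obtain ⟨o, ho⟩ := 𝔬.continuous' p
  refine ⟨o, ?_⟩
  filter_upwards [ho, (chartAt H p).open_source.mem_nhds (mem_chart_source H p)] with r h1 h2
  exact (mapsOrientation_extChartAt_iff h2).1 h1

/-- An orientation from a continuous section of the orientation cover. -/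
def ofSection (s : M → OrientationCover I M) (hs : Continuous s)
    (hp : ∀ x, OrientationCover.proj I M (s x) = x) : ManifoldOrientation I M where
  at_point x := (s x).modelOrientation
  continuous' p := by
    refine ⟨(s p).modelOrientation, ?_⟩
    have hU := (hs.continuousAt (x := p)).eventually
      ((chartAt H (s p)).open_source.mem_nhds (mem_chart_source H (s p)))
    filter_upwards [hU] with r (hr : s r ∈ (chartAt H (s p)).source)
    have hpp : (s p).point = p := hp p
    have hrr : (s r).point = r := hp r
    -- Lying in one sheet means exactly that the chart carries the orientations to one fixed
    -- orientation of the model.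
    rw [OrientationCover.chartAt_eq_sheet, OrientationCover.mem_sheet_source, hpp, hrr] at hr
    exact (mapsOrientation_extChartAt_iff hr.1).2 hr.2

end ManifoldOrientation

/-! ### Differentials and smoothness of the projection and the deck map -/

namespace OrientationCover

instance instIsManifold {m : ℕ∞ω} [IsManifold I m M] : IsManifold I m (OrientationCover I M) :=
  isManifold

/-- The charts at `q` and `u q` are given by the same formula, which sees only the base point; in
them `u` is the identity. -/
theorem hasMFDerivAt_of_point {u : OrientationCover I M → OrientationCover I M}
    (hu : Continuous u) (hp : ∀ r, (u r).point = r.point) (q : OrientationCover I M) :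
    HasMFDerivAt I I u q (ContinuousLinearMap.id ℝ (EuclideanSpace ℝ (Fin n))) := by
  refine ⟨hu.continuousAt, ?_⟩
  refine (hasFDerivWithinAt_id _ _).congr_of_eventuallyEq ?_ ?_
  · filter_upwards [extChartAt_target_mem_nhdsWithin (I := I) q] with z hz
    have h : writtenInExtChartAt I I q u z = extChartAt I q ((extChartAt I q).symm z) := by
      change I (chartAt H (u q).point (u ((extChartAt I q).symm z)).point) =
        I (chartAt H q.point ((extChartAt I q).symm z).point)
      rw [hp, hp]
    rw [h]
    exact (extChartAt I q).right_inv hz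
  · have h : writtenInExtChartAt I I q u (extChartAt I q q) =
        extChartAt I q ((extChartAt I q).symm (extChartAt I q q)) := by
      change I (chartAt H (u q).point (u ((extChartAt I q).symm (extChartAt I q q))).point) =
        I (chartAt H q.point ((extChartAt I q).symm (extChartAt I q q)).point)
      rw [hp, hp]
    rw [h]
    exact (extChartAt I q).right_inv (mem_extChartAt_target q)

theorem hasMFDerivAt_deck (q : OrientationCover I M) :
    HasMFDerivAt I I deck q (ContinuousLinearMap.id ℝ (EuclideanSpace ℝ (Fin n))) :=
  hasMFDerivAt_of_point continuous_deck (fun _ => rfl) q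

theorem hasMFDerivAt_proj (q : OrientationCover I M) :
    HasMFDerivAt I I (proj I M) q (ContinuousLinearMap.id ℝ (EuclideanSpace ℝ (Fin n))) := by
  refine ⟨continuous_proj.continuousAt, ?_⟩
  refine (hasFDerivWithinAt_id _ _).congr_of_eventuallyEq ?_ ?_
  · filter_upwards [extChartAt_target_mem_nhdsWithin (I := I) q] with z hz
    exact (extChartAt I q).right_inv hz
  · exact (extChartAt I q).right_inv (mem_extChartAt_target q)

/-- This equality of maps on the model space carries critical points and chart differentials from
`M` to the cover without any change of coordinates. -/
theorem mfderiv_comp_proj {E' H' N : Type*} [NormedAddCommGroup E'] [NormedSpace ℝ E']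
    [TopologicalSpace H'] {J : ModelWithCorners ℝ E' H'} [TopologicalSpace N] [ChartedSpace H' N]
    {u : M → N} {q : OrientationCover I M} (hu : MDifferentiableAt I J u (proj I M q)) :
    mfderiv I J (u ∘ proj I M) q = mfderiv I J u (proj I M q) := by
  have h := (hu.hasMFDerivAt.comp q (hasMFDerivAt_proj q)).mfderiv
  rw [h]
  ext1 v
  rfl

theorem contMDiffOn_localProj {m : ℕ∞ω} [IsManifold I m M] (e : atlas H M)
    (o : Orientation ℝ (EuclideanSpace ℝ (Fin n)) (Fin n)) :
    ContMDiffOn I I m (localProj e o) (localProj (I := I) e o).source := by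
  have h1 : sheet (I := I) e o ∈ IsManifold.maximalAtlas I m (OrientationCover I M) :=
    IsManifold.subset_maximalAtlas (I := I) (n := m) (mem_atlas_iff.2 ⟨e, o, rfl⟩)
  have h2 : e.1 ∈ IsManifold.maximalAtlas I m M := IsManifold.subset_maximalAtlas e.2
  exact (contMDiffOn_symm_of_mem_maximalAtlas h2).comp
    ((contMDiffOn_of_mem_maximalAtlas h1).mono inter_subset_left) inter_subset_right

theorem contMDiffOn_localProj_symm {m : ℕ∞ω} [IsManifold I m M] (e : atlas H M)
    (o : Orientation ℝ (EuclideanSpace ℝ (Fin n)) (Fin n)) :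
    ContMDiffOn I I m (localProj (I := I) e o).symm (localProj (I := I) e o).target := by
  have h1 : sheet (I := I) e o ∈ IsManifold.maximalAtlas I m (OrientationCover I M) :=
    IsManifold.subset_maximalAtlas (I := I) (n := m) (mem_atlas_iff.2 ⟨e, o, rfl⟩)
  have h2 : e.1 ∈ IsManifold.maximalAtlas I m M := IsManifold.subset_maximalAtlas e.2
  exact (contMDiffOn_symm_of_mem_maximalAtlas h1).comp
    ((contMDiffOn_of_mem_maximalAtlas h2).mono inter_subset_left) inter_subset_right

theorem contMDiff_proj {m : ℕ∞ω} [IsManifold I m M] : ContMDiff I I m (proj I M) := by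
  intro q
  have hq := mem_sheet_source_self q
  have hO := (sheet (I := I) (achart H q.point) q.modelOrientation).open_source
  have h : ContMDiffOn I I m (localProj (achart H q.point) q.modelOrientation)
      (sheet (I := I) (achart H q.point) q.modelOrientation).source := by
    rw [← localProj_source]
    exact contMDiffOn_localProj (achart H q.point) q.modelOrientation
  refine (h.contMDiffAt (hO.mem_nhds hq)).congr_of_eventuallyEq ?_
  filter_upwards [hO.mem_nhds hq] with r hr using (localProj_apply hr).symm

theorem localProj_symm_proj {e : atlas H M}
    {o : Orientation ℝ (EuclideanSpace ℝ (Fin n)) (Fin n)} {q : OrientationCover I M}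
    (hq : q ∈ (sheet e o).source) : (localProj (I := I) e o).symm (proj I M q) = q := by
  rw [← localProj_apply hq]
  exact (localProj (I := I) e o).left_inv (by rwa [localProj_source])

/-- Smoothness of maps into the orientation cover can be checked after projection. -/
theorem contMDiffWithinAt_of_proj {E' H' N : Type*} [NormedAddCommGroup E'] [NormedSpace ℝ E']
    [TopologicalSpace H'] {J : ModelWithCorners ℝ E' H'} [TopologicalSpace N] [ChartedSpace H' N]
    {m : ℕ∞ω} [IsManifold I m M] {s : Set N} {y : N} {u : N → OrientationCover I M}
    (hc : ContinuousWithinAt u s y) (h : ContMDiffWithinAt J I m (proj I M ∘ u) s y) :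
    ContMDiffWithinAt J I m u s y := by
  let e := achart H (u y).point
  let o := (u y).modelOrientation
  have hy : u y ∈ (sheet e o).source := mem_sheet_source_self (u y)
  have ht : proj I M (u y) ∈ (localProj (I := I) e o).target := by
    rw [localProj_target]; exact hy.1
  have h1 : ContMDiffAt I I m (localProj (I := I) e o).symm ((proj I M ∘ u) y) :=
    (contMDiffOn_localProj_symm e o).contMDiffAt
      ((localProj (I := I) e o).open_target.mem_nhds ht)
  refine (h1.comp_contMDiffWithinAt y h).congr_of_eventuallyEq ?_ (localProj_symm_proj hy).symm
  filter_upwards [hc ((sheet (I := I) e o).open_source.mem_nhds hy)] with z hz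
    using (localProj_symm_proj hz).symm

theorem contMDiff_deck {m : ℕ∞ω} [IsManifold I m M] :
    ContMDiff I I m (deck : OrientationCover I M → OrientationCover I M) := by
  intro q
  rw [← contMDiffWithinAt_univ]
  exact contMDiffWithinAt_of_proj continuous_deck.continuousWithinAt
    (contMDiff_proj.contMDiffAt.contMDiffWithinAt)

/-- The orientation cover is tautologically oriented. -/
def tautologicalOrientation : ManifoldOrientation I (OrientationCover I M) where
  at_point q := q.modelOrientation
  continuous' p := by
    refine ⟨p.modelOrientation, ?_⟩
    filter_upwards [(chartAt H p).open_source.mem_nhds (mem_chart_source H p)] with q hq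
    have h2 := (mapsOrientation_extChartAt_iff hq.1).2 (mem_sheet_source.1 hq).2
    have h3 : differentialAt I (extChartAt I p) q =
        differentialAt I (extChartAt I p.point) q.point :=
      mfderiv_comp_proj (q := q) (mdifferentiableAt_extChartAt hq.1)
    rw [h3]
    exact h2

theorem isOrientableManifold : IsOrientableManifold I (OrientationCover I M) :=
  ⟨tautologicalOrientation⟩

end OrientationCover

/-- Two orientations of a manifold agree on an open and closed set. -/
theorem ManifoldOrientation.isClopen_eq (𝔬 𝔬' : ManifoldOrientation I M) :
    IsClopen {q | 𝔬.at_point q = 𝔬'.at_point q} := by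
  -- In the chart at `p` both orientations are locally constant, so whether they agree is locally
  -- constant too.
  have key (p : M) : ∀ᶠ r in 𝓝 p, (𝔬.at_point r = 𝔬'.at_point r ↔
      𝔬.at_point p = 𝔬'.at_point p) := by
    obtain ⟨o, ho⟩ := 𝔬.eventually_transportOrientation p
    obtain ⟨o', ho'⟩ := 𝔬'.eventually_transportOrientation p
    have hi (r : M) (h : transportOrientation (chartChange I (achart H r) (achart H p) r)
        (𝔬.at_point r) = o) (h' : transportOrientation (chartChange I (achart H r) (achart H p) r)
        (𝔬'.at_point r) = o') : 𝔬.at_point r = 𝔬'.at_point r ↔ o = o' := by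
      rw [← h, ← h']
      exact transportOrientation_inj.symm
    filter_upwards [ho, ho'] with r h h'
    rw [hi r h h', hi p ho.self_of_nhds ho'.self_of_nhds]
  constructor
  · rw [← isOpen_compl_iff, isOpen_iff_mem_nhds]
    intro p hp
    filter_upwards [key p] with r hr h
    exact hp (hr.1 h)
  · rw [isOpen_iff_mem_nhds]
    intro p hp
    filter_upwards [key p] with r hr
    exact hr.2 hp

/-! ### Connectedness of the cover and orientation reversal by the deck map -/

namespace OrientationCover

/-- The orientation cover of a connected non-orientable manifold is connected. -/
theorem connectedSpace [ConnectedSpace M] (h : ¬ IsOrientableManifold I M) :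
    ConnectedSpace (OrientationCover I M) := by
  have hne : Nonempty (OrientationCover I M) :=
    ⟨⟨Classical.arbitrary M, (EuclideanSpace.basisFun (Fin n) ℝ).toBasis.orientation⟩⟩
  -- A deck-invariant set and its complement have complementary images. As `proj` is open, the image
  -- of an invariant clopen set is clopen in the connected base.
  have hinv (B : Set (OrientationCover I M)) (hB : IsClopen B) (hd : deck ⁻¹' B = B) :
      B = ∅ ∨ B = univ := by
    have himg : proj I M '' Bᶜ = (proj I M '' B)ᶜ := by
      ext x
      constructor
      · rintro ⟨q, hq, rfl⟩ ⟨q', hq', hqq⟩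
        rcases eq_or_eq_deck hqq with rfl | rfl
        · exact hq hq'
        · exact hq (hd ▸ hq')
      · intro hx
        refine ⟨⟨x, (EuclideanSpace.basisFun (Fin n) ℝ).toBasis.orientation⟩, ?_, rfl⟩
        exact fun hq => hx ⟨_, hq, rfl⟩
    have hcl : IsClopen (proj I M '' B) :=
      ⟨by rw [← isOpen_compl_iff, ← himg]; exact isOpenMap_proj _ hB.compl.isOpen,
        isOpenMap_proj _ hB.isOpen⟩
    rcases isClopen_iff.1 hcl with h | h
    · exact Or.inl (image_eq_empty.1 h)
    · right
      rw [h, compl_univ, image_eq_empty] at himg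
      exact compl_empty_iff.1 himg
  have hp : PreconnectedSpace (OrientationCover I M) := by
    rw [preconnectedSpace_iff_clopen]
    intro A hA
    have hA' : IsClopen (deck ⁻¹' A) := hA.preimage continuous_deck
    have hdd : deck ⁻¹' (deck ⁻¹' A) = A := by ext q; simp
    rcases hinv (A ∩ deck ⁻¹' A) (hA.inter hA') (by rw [preimage_inter, hdd, inter_comm]) with h1 | h1
    · rcases hinv (A ∪ deck ⁻¹' A) (hA.union hA') (by rw [preimage_union, hdd, union_comm])
        with h2 | h2
      · exact Or.inl (union_empty_iff.1 h2).1
      · exfalso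
        -- Here `A` contains exactly one of the two points over each `x`, so it is the image of a
        -- section, continuous because `proj` is open.
        have hex (x : M) : ∃ q ∈ A, proj I M q = x := by
          let q : OrientationCover I M :=
            ⟨x, (EuclideanSpace.basisFun (Fin n) ℝ).toBasis.orientation⟩
          rcases (h2 ▸ mem_univ q : q ∈ A ∪ deck ⁻¹' A) with hq | hq
          · exact ⟨q, hq, rfl⟩
          · exact ⟨deck q, hq, rfl⟩
        choose s hsA hsp using hex
        have huniq (q q' : OrientationCover I M) (hq : q ∈ A) (hq' : q' ∈ A)
            (hqq : proj I M q = proj I M q') : q = q' := by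
          rcases eq_or_eq_deck hqq with rfl | rfl
          · rfl
          · exact absurd (h1 ▸ ⟨hq', hq⟩ : q' ∈ (∅ : Set _)) (notMem_empty _)
        refine h ⟨ManifoldOrientation.ofSection s ?_ hsp⟩
        rw [continuous_def]
        intro V hV
        have : s ⁻¹' V = proj I M '' (V ∩ A) := by
          ext x
          constructor
          · intro hx
            exact ⟨s x, ⟨hx, hsA x⟩, hsp x⟩
          · rintro ⟨q, ⟨hqV, hqA⟩, rfl⟩
            rw [mem_preimage, huniq _ q (hsA _) hqA (hsp _)]
            exact hqV
        rw [this]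
        exact isOpenMap_proj _ (hV.inter hA.isOpen)
    · exact Or.inr (univ_subset_iff.1 (h1 ▸ inter_subset_left))
  exact ⟨hne⟩

/-- Deck transformations reverse every orientation of a connected orientation cover. -/
theorem at_point_deck [ConnectedSpace (OrientationCover I M)]
    (𝔬 : ManifoldOrientation I (OrientationCover I M)) (q : OrientationCover I M) :
    (𝔬.at_point (deck q) : Orientation ℝ (EuclideanSpace ℝ (Fin n)) (Fin n)) =
      -𝔬.at_point q := by
  -- By connectedness the orientation is everywhere the negative of the tautological one, or
  -- everywhere equal to it; the deck map negates the latter by construction.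
  rcases isClopen_iff.1 (𝔬.isClopen_eq tautologicalOrientation) with h | h
  · have key (r : OrientationCover I M) :
        (𝔬.at_point r : Orientation ℝ (EuclideanSpace ℝ (Fin n)) (Fin n)) =
          -r.modelOrientation := by
      rcases model_orientation_eq_or (𝔬.at_point r) r.modelOrientation with h' | h'
      · exact absurd (h ▸ h' : r ∈ (∅ : Set _)) (notMem_empty _)
      · exact h'
    exact (key _).trans (congrArg (fun o => -o) (key q).symm)
  · have key (r : OrientationCover I M) :
        (𝔬.at_point r : Orientation ℝ (EuclideanSpace ℝ (Fin n)) (Fin n)) =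
          r.modelOrientation := (h ▸ mem_univ r : r ∈ {q | _ = _})
    exact (key _).trans (congrArg (fun o => -o) (key q).symm)

end OrientationCover

end

end

noncomputable section

/-! ### Derivatives in a fixed chart -/

/-- For a right inverse `R` of `A`, the determinant of `B R` is continuous in `B` and equals `1` at
`A`; where it is nonzero, `B` is onto. -/
theorem ContinuousLinearMap.eventually_surjective {E F : Type*} [NormedAddCommGroup E]
    [NormedSpace ℝ E] [NormedAddCommGroup F] [NormedSpace ℝ F] [FiniteDimensional ℝ F]
    {A : E →L[ℝ] F} (hA : Function.Surjective A) : ∀ᶠ B : E →L[ℝ] F in 𝓝 A, Function.Surjective B := by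
  obtain ⟨R, hR⟩ := A.toLinearMap.exists_rightInverse_of_surjective (LinearMap.range_eq_top.2 hA)
  let R' : F →L[ℝ] E := LinearMap.toContinuousLinearMap R
  have hc : Continuous fun B : E →L[ℝ] F => (B.comp R').det :=
    ContinuousLinearMap.continuous_det.comp ((ContinuousLinearMap.compL ℝ F E F).flip R').continuous
  have h0 : (A.comp R').det ≠ 0 := by
    have : A.comp R' = ContinuousLinearMap.id ℝ F := by
      ext1 v
      exact LinearMap.congr_fun hR v
    rw [this]
    simp [ContinuousLinearMap.det]
  filter_upwards [hc.continuousAt.eventually_ne h0] with B hB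
  have hs := ((B.comp R').toContinuousLinearEquivOfDetNeZero hB).surjective
  intro w
  obtain ⟨v, hv⟩ := hs w
  exact ⟨R' v, hv⟩

section

variable {n : ℕ} {H : Type*} [TopologicalSpace H]
  {I : ModelWithCorners ℝ (EuclideanSpace ℝ (Fin n)) H}
  {M : Type*} [TopologicalSpace M] [ChartedSpace H M] [IsManifold I 1 M]
  {F : Type*} [NormedAddCommGroup F] [NormedSpace ℝ F]

/-- Near a point `p`, a `C¹` map on a set to a vector space has derivatives which, read in the
chart at `p`, are continuous at `p`. -/
theorem ContMDiffWithinAt.exists_derivative {u : M → F} {s : Set M} {p : M}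
    (hu : ContMDiffWithinAt I 𝓘(ℝ, F) 1 u s p) (hp : p ∈ s) :
    ∃ D : M → EuclideanSpace ℝ (Fin n) →L[ℝ] F, ContinuousWithinAt D s p ∧
      ∀ᶠ r in 𝓝[s] p, HasMFDerivWithinAt I 𝓘(ℝ, F) u s r
        ((D r).comp (chartChange I (achart H r) (achart H p) r)) := by
  have h1 := (contMDiffWithinAt_iff.1 hu).2
  have h2 : ContDiffWithinAt ℝ (0 + 1) (u ∘ (extChartAt I p).symm)
      ((extChartAt I p).symm ⁻¹' s ∩ range I) (extChartAt I p p) := h1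
  obtain ⟨U, hU, -, -, f', hf', hf'c⟩ :=
    (contDiffWithinAt_succ_iff_hasFDerivWithinAt' (by simp)).1 h2
  have hpm : extChartAt I p p ∈ (extChartAt I p).symm ⁻¹' s ∩ range I := by
    refine ⟨?_, mem_range_self _⟩
    rw [mem_preimage, extChartAt_to_inv]
    exact hp
  rw [insert_eq_of_mem hpm] at hU
  have hmaps : ∀ r ∈ s ∩ (chartAt H p).source,
      extChartAt I p r ∈ (extChartAt I p).symm ⁻¹' s ∩ range I := by
    rintro r ⟨hr, hrs⟩
    refine ⟨?_, mem_range_self _⟩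
    rw [mem_preimage, (extChartAt I p).left_inv (by rwa [extChartAt_source])]
    exact hr
  have hsrc : (chartAt H p).source ∈ 𝓝 p := (chartAt H p).open_source.mem_nhds (mem_chart_source H p)
  have htend : Tendsto (extChartAt I p) (𝓝[s] p)
      (𝓝[(extChartAt I p).symm ⁻¹' s ∩ range I] (extChartAt I p p)) := by
    refine tendsto_nhdsWithin_of_tendsto_nhds_of_eventually_within _
      ((continuousAt_extChartAt p).mono_left nhdsWithin_le_nhds) ?_
    filter_upwards [self_mem_nhdsWithin, mem_nhdsWithin_of_mem_nhds hsrc] with r hr hrs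
      using hmaps r ⟨hr, hrs⟩
  -- The derivative is that of `u` read in the fixed chart at `p`; the factor `chartChange` converts
  -- from the chart at `r`.
  refine ⟨fun r => f' (extChartAt I p r), ?_, ?_⟩
  · exact hf'c.continuousWithinAt.tendsto.comp htend
  · filter_upwards [htend hU, self_mem_nhdsWithin, mem_nhdsWithin_of_mem_nhds hsrc]
      with r hrU hrs hr
    have hd : HasMFDerivWithinAt 𝓘(ℝ, EuclideanSpace ℝ (Fin n)) 𝓘(ℝ, F)
        (u ∘ (extChartAt I p).symm) ((extChartAt I p).symm ⁻¹' s ∩ range I) (extChartAt I p r)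
        (f' (extChartAt I p r)) := (hf' _ hrU).hasMFDerivWithinAt
    have hext := (hasMFDerivAt_extChartAt_chartChange (I := I) hr).hasMFDerivWithinAt
      (s := s ∩ (chartAt H p).source)
    have hcomp := HasMFDerivWithinAt.comp r hd hext hmaps
    have hcomp' := hcomp.congr_of_eventuallyEq (f₁ := u) (by
      filter_upwards [self_mem_nhdsWithin] with z hz
      change u z = u ((extChartAt I p).symm (extChartAt I p z))
      rw [(extChartAt I p).left_inv (by rw [extChartAt_source]; exact hz.2)]) (by
      change u r = u ((extChartAt I p).symm (extChartAt I p r))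
      rw [(extChartAt I p).left_inv (by rwa [extChartAt_source])])
    exact (hasMFDerivWithinAt_inter ((chartAt H p).open_source.mem_nhds hr)).1 hcomp'

theorem ContMDiffAt.exists_derivative {u : M → F} {p : M}
    (hu : ContMDiffAt I 𝓘(ℝ, F) 1 u p) :
    ∃ D : M → EuclideanSpace ℝ (Fin n) →L[ℝ] F, ContinuousAt D p ∧
      ∀ᶠ r in 𝓝 p, HasMFDerivAt I 𝓘(ℝ, F) u r
        ((D r).comp (chartChange I (achart H r) (achart H p) r)) := by
  obtain ⟨D, h1, h2⟩ := ContMDiffWithinAt.exists_derivative (s := univ) hu (mem_univ p)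
  rw [continuousWithinAt_univ] at h1
  rw [nhdsWithin_univ] at h2
  exact ⟨D, h1, h2.mono fun r hr => hasMFDerivWithinAt_univ.1 hr⟩

/-- The points at which a differential is surjective form a neighbourhood of each of them. -/
theorem eventually_notMem_criticalPoints {E' H' N : Type*} [NormedAddCommGroup E']
    [NormedSpace ℝ E'] [FiniteDimensional ℝ E'] [TopologicalSpace H']
    {J : ModelWithCorners ℝ E' H'} [TopologicalSpace N] [ChartedSpace H' N] [IsManifold J 1 N]
    {u : M → N} (hu : ContMDiff I J 1 u) {p : M} (hp : p ∉ criticalPoints I J u) :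
    ∀ᶠ r in 𝓝 p, r ∉ criticalPoints I J u := by
  have hup : ContMDiffAt I 𝓘(ℝ, E') 1 (extChartAt J (u p) ∘ u) p :=
    contMDiffAt_extChartAt.comp p hu.contMDiffAt
  obtain ⟨D, hD, hder⟩ := hup.exists_derivative
  have hsrc : ∀ᶠ r in 𝓝 p, u r ∈ (chartAt H' (u p)).source :=
    hu.continuous.continuousAt.eventually
      ((chartAt H' (u p)).open_source.mem_nhds (mem_chart_source H' (u p)))
  have hsp : (chartAt H p).source ∈ 𝓝 p := (chartAt H p).open_source.mem_nhds (mem_chart_source H p)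
  have hcomp (r : M) (hr : u r ∈ (chartAt H' (u p)).source)
      (h : HasMFDerivAt I 𝓘(ℝ, E') (extChartAt J (u p) ∘ u) r
        ((D r).comp (chartChange I (achart H r) (achart H p) r))) (v : EuclideanSpace ℝ (Fin n)) :
      D r (chartChange I (achart H r) (achart H p) r v) =
        mfderiv J 𝓘(ℝ, E') (extChartAt J (u p)) (u r) (mfderiv I J u r v) := by
    have h1 := (mdifferentiableAt_extChartAt hr).hasMFDerivAt.comp r
      (hu.mdifferentiable one_ne_zero r).hasMFDerivAt
    exact DFunLike.congr_fun (hasMFDerivAt_unique h h1) v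
  have hbij (r : M) (hr : u r ∈ (chartAt H' (u p)).source) : Function.Bijective
      (mfderiv J 𝓘(ℝ, E') (extChartAt J (u p)) (u r)) := by
    obtain ⟨L, hL⟩ := isInvertible_mfderiv_extChartAt (I := J) (x := u p) (y := u r)
      (by rwa [extChartAt_source])
    rw [← hL]
    exact L.bijective
  have hDs : Function.Surjective (D p) := by
    intro w
    obtain ⟨a, ha⟩ := (hbij p (mem_chart_source H' (u p))).2 w
    obtain ⟨b, hb⟩ := not_not.1 hp a
    refine ⟨chartChange I (achart H p) (achart H p) p b, ?_⟩
    refine (hcomp p (mem_chart_source H' (u p)) hder.self_of_nhds b).trans ?_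
    rw [hb]
    exact ha
  -- `D` differs from the differential of `u` only by invertible chart differentials, so
  -- surjectivity passes to it, spreads to nearby points and passes back.
  have hDev : ∀ᶠ r in 𝓝 p, Function.Surjective (D r) :=
    hD.eventually (p := fun B : EuclideanSpace ℝ (Fin n) →L[ℝ] E' => Function.Surjective B)
      (ContinuousLinearMap.eventually_surjective hDs)
  filter_upwards [hder, hsrc, hDev, hsp]
    with r h1 h2 h3 h4
  refine not_not.2 fun a => ?_
  obtain ⟨b, hb⟩ := h3 (mfderiv J 𝓘(ℝ, E') (extChartAt J (u p)) (u r) a)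
  let L := (chartChange I (achart H r) (achart H p) r).toContinuousLinearEquivOfDetNeZero
    (chartChange_det_ne_zero I _ _ (mem_chart_source H r) h4)
  refine ⟨L.symm b, (hbij r h2).1 ?_⟩
  rw [← hb, ← hcomp r h2 h1]
  exact congrArg (D r) (L.apply_symm_apply b)

end
end

noncomputable section

/-! ### Smooth charts and local models -/

theorem MapsOrientation.comp {U V W : Type*} [AddCommGroup U] [Module ℝ U] [AddCommGroup V]
    [Module ℝ V] [AddCommGroup W] [Module ℝ W] {n : ℕ} {A : U →ₗ[ℝ] V} {B : V →ₗ[ℝ] W}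
    {o : Orientation ℝ U (Fin n)} {o' : Orientation ℝ V (Fin n)} {o'' : Orientation ℝ W (Fin n)}
    (hB : MapsOrientation B o' o'') (hA : MapsOrientation A o o') :
    MapsOrientation (B ∘ₗ A) o o'' := by
  obtain ⟨L, rfl, rfl⟩ := hA
  obtain ⟨L', rfl, rfl⟩ := hB
  refine ⟨L.trans L', rfl, ?_⟩
  induction o using Module.Ray.ind with
  | h v hv => rfl

section IsSmoothChart

variable {E F H M : Type*} [NormedAddCommGroup E] [NormedSpace ℝ E]
  [NormedAddCommGroup F] [NormedSpace ℝ F] [TopologicalSpace H]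
  {I : ModelWithCorners ℝ E H} [TopologicalSpace M] [ChartedSpace H M]
  {e : OpenPartialHomeomorph M F}

theorem IsSmoothChart.mdifferentiable (he : IsSmoothChart I e) :
    e.MDifferentiable I 𝓘(ℝ, F) :=
  ⟨he.1.mdifferentiableOn (by simp), he.2.mdifferentiableOn (by simp)⟩

theorem IsSmoothChart.restrOpen (he : IsSmoothChart I e) {s : Set M} (hs : IsOpen s) :
    IsSmoothChart I (e.restrOpen s hs) :=
  ⟨he.1.mono inter_subset_left, he.2.mono inter_subset_left⟩

theorem IsSmoothChart.trans_left {E' H' N : Type*} [NormedAddCommGroup E'] [NormedSpace ℝ E']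
    [TopologicalSpace H'] {J : ModelWithCorners ℝ E' H'} [TopologicalSpace N] [ChartedSpace H' N]
    (he : IsSmoothChart I e) {d : OpenPartialHomeomorph N M}
    (hd : ContMDiffOn J I ∞ d d.source) (hd' : ContMDiffOn I J ∞ d.symm d.target) :
    IsSmoothChart J (d.trans e) :=
  ⟨he.1.comp (hd.mono inter_subset_left) inter_subset_right,
    hd'.comp (he.2.mono inter_subset_left) inter_subset_right⟩

end IsSmoothChart

section LocalModel

variable {X S : Type*} [TopologicalSpace X] [ChartedSpace (EuclideanHalfSpace 4) X]
  [TopologicalSpace S] [ChartedSpace (EuclideanHalfSpace 2) S]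
  {f : X → S} {x : X} {φ : OpenPartialHomeomorph X (ℂ × ℂ)} {ψ : OpenPartialHomeomorph S ℂ}

theorem IsLefschetzChartPair.restrOpen (h : IsLefschetzChartPair f x φ ψ) {s : Set X}
    (hs : IsOpen s) (hx : x ∈ s) : IsLefschetzChartPair f x (φ.restrOpen s hs) ψ where
  smooth_total := h.smooth_total.restrOpen hs
  smooth_base := h.smooth_base
  mem_total := ⟨h.mem_total, hx⟩
  mapsTo := h.mapsTo.mono_left inter_subset_left
  eq_mul p hp := h.eq_mul p hp.1

theorem IsLefschetzChartPair.trans_left {Y : Type*} [TopologicalSpace Y]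
    [ChartedSpace (EuclideanHalfSpace 4) Y] (h : IsLefschetzChartPair f x φ ψ)
    {d : OpenPartialHomeomorph Y X} (hd : ContMDiffOn (𝓡∂ 4) (𝓡∂ 4) ∞ d d.source)
    (hd' : ContMDiffOn (𝓡∂ 4) (𝓡∂ 4) ∞ d.symm d.target) {k : Y → S} {y : Y}
    (hy : y ∈ d.source) (hyx : d y = x) (hk : ∀ z ∈ d.source, k z = f (d z)) :
    IsLefschetzChartPair k y (d.trans φ) ψ where
  smooth_total := h.smooth_total.trans_left hd hd'
  smooth_base := h.smooth_base
  mem_total := ⟨hy, show d y ∈ φ.source from hyx ▸ h.mem_total⟩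
  mapsTo z hz := by rw [hk z hz.1]; exact h.mapsTo hz.2
  eq_mul z hz := by rw [hk z hz.1]; exact h.eq_mul _ hz.2

/-- In the local model, the only possible critical point is the origin. -/
theorem IsLefschetzChartPair.eq_zero_of_mem_criticalPoints (h : IsLefschetzChartPair f x φ ψ)
    (hf : MDifferentiable (𝓡∂ 4) (𝓡∂ 2) f) {p : X} (hp : p ∈ φ.source)
    (hc : p ∈ criticalPoints (𝓡∂ 4) (𝓡∂ 2) f) : φ p = 0 := by
  by_contra hne
  refine hc ?_
  have hφ := h.smooth_total.mdifferentiable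
  have hψ := h.smooth_base.mdifferentiable
  have h1 := (hψ.mdifferentiableAt (h.mapsTo hp)).hasMFDerivAt.comp p (hf p).hasMFDerivAt
  have hm : HasMFDerivAt 𝓘(ℝ, ℂ × ℂ) 𝓘(ℝ, ℂ) (fun z : ℂ × ℂ => z.1 * z.2) (φ p)
      ((φ p).1 • ContinuousLinearMap.snd ℝ ℂ ℂ + (φ p).2 • ContinuousLinearMap.fst ℝ ℂ ℂ) := by
    have : HasFDerivAt (fun z : ℂ × ℂ => z.1 * z.2)
      ((φ p).1 • ContinuousLinearMap.snd ℝ ℂ ℂ + (φ p).2 • ContinuousLinearMap.fst ℝ ℂ ℂ) (φ p) :=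
      hasFDerivAt_fst.mul hasFDerivAt_snd
    exact this.hasMFDerivAt
  have h2 := hm.comp p (hφ.mdifferentiableAt hp).hasMFDerivAt
  have h3 : ψ ∘ f =ᶠ[𝓝 p] (fun z : ℂ × ℂ => z.1 * z.2) ∘ φ := by
    filter_upwards [φ.open_source.mem_nhds hp] with q hq using h.eq_mul q hq
  have h4 := hasMFDerivAt_unique h1 (h2.congr_of_eventuallyEq h3)
  intro a
  have key (t : ℂ) : ∃ c : ℂ × ℂ, (φ p).1 * c.2 + (φ p).2 * c.1 = t := by
    by_cases hz : (φ p).1 = 0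
    · have hw : (φ p).2 ≠ 0 := fun hw => hne (Prod.ext hz hw)
      exact ⟨((φ p).2⁻¹ * t, 0), by simp [hw]⟩
    · exact ⟨(0, (φ p).1⁻¹ * t), by simp [hz]⟩
  obtain ⟨c, hc⟩ := key (mfderiv (𝓡∂ 2) 𝓘(ℝ, ℂ) ψ (f p) a)
  obtain ⟨b, hb⟩ := hφ.mfderiv_surjective hp c
  -- The differential of `ψ` is injective, so it is enough to hit `a` after applying it, where `f`
  -- has become multiplication.
  refine ⟨b, hψ.mfderiv_injective (h.mapsTo hp) ?_⟩
  refine Eq.trans ?_ hc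
  rw [← hb]
  exact DFunLike.congr_fun h4 b

/-- Every point has a neighbourhood with at most one critical point: a Lefschetz chart at critical
points, an open set of regular points elsewhere. Finitely many of these cover `X`. -/
theorem IsLefschetzFibration.finite_criticalPoints (hf : IsLefschetzFibration f) :
    (criticalPoints (𝓡∂ 4) (𝓡∂ 2) f).Finite := by
  have := hf.total.compact
  have := hf.total.smooth
  have := hf.base.smooth
  have hloc (p : X) : ∃ U ∈ 𝓝 p, (U ∩ criticalPoints (𝓡∂ 4) (𝓡∂ 2) f).Subsingleton := by
    by_cases hp : p ∈ criticalPoints (𝓡∂ 4) (𝓡∂ 2) f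
    · obtain ⟨φ, ψ, h⟩ := hf.critical_chart p hp
      refine ⟨φ.source, φ.open_source.mem_nhds h.mem_total, ?_⟩
      rintro a ⟨ha, hac⟩ b ⟨hb, hbc⟩
      have hd := hf.smooth.mdifferentiable (by simp)
      exact φ.injOn ha hb ((h.eq_zero_of_mem_criticalPoints hd ha hac).trans
        (h.eq_zero_of_mem_criticalPoints hd hb hbc).symm)
    · have := eventually_notMem_criticalPoints (hf.smooth.of_le (by simp)) hp
      refine ⟨_, this, ?_⟩
      rintro a ⟨ha, hac⟩
      exact absurd hac ha
  choose U hU hUs using hloc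
  obtain ⟨t, ht⟩ := CompactSpace.elim_nhds_subcover U hU
  have : criticalPoints (𝓡∂ 4) (𝓡∂ 2) f = ⋃ p ∈ t, (U p ∩ criticalPoints (𝓡∂ 4) (𝓡∂ 2) f) := by
    rw [← iUnion₂_inter, ht, top_eq_univ, univ_inter]
  rw [this]
  exact t.finite_toSet.biUnion fun p _ => (hUs p).finite

theorem complexPlane_orientation_eq_or (o : Orientation ℝ (ℂ × ℂ) (Fin 4)) :
    o = complexPlaneOrientation ∨ o = -complexPlaneOrientation :=
  o.eq_or_eq_neg _ (by simp [Module.finrank_prod, Complex.finrank_real_complex])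

/-- After shrinking, a smooth chart carries a given orientation to a constant one. -/
theorem IsSmoothChart.exists_chartMapsOrientation [IsManifold (𝓡∂ 4) ∞ X]
    (hφ : IsSmoothChart (𝓡∂ 4) φ) (hx : x ∈ φ.source) (𝔬 : ManifoldOrientation (𝓡∂ 4) X) :
    ∃ (s : Set X) (hs : IsOpen s) (o : Orientation ℝ (ℂ × ℂ) (Fin 4)), x ∈ s ∧
      ChartMapsOrientation 𝔬 (φ.restrOpen s hs) o := by
  have hu : ContMDiffAt (𝓡∂ 4) 𝓘(ℝ, ℂ × ℂ) 1 φ x :=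
    (hφ.1.contMDiffAt (φ.open_source.mem_nhds hx)).of_le (by simp)
  obtain ⟨D, hD, hder⟩ := hu.exists_derivative
  obtain ⟨o, ho⟩ := 𝔬.eventually_transportOrientation x
  -- Any linear identification will do: it only makes the determinant of the chart differential
  -- meaningful, and it is undone at the end.
  let κ : (ℂ × ℂ) ≃L[ℝ] EuclideanSpace ℝ (Fin 4) := ContinuousLinearEquiv.ofFinrankEq
    (by simp [Module.finrank_prod, Complex.finrank_real_complex])
  let B : X → EuclideanSpace ℝ (Fin 4) →L[ℝ] EuclideanSpace ℝ (Fin 4) :=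
    fun r => (κ : (ℂ × ℂ) →L[ℝ] EuclideanSpace ℝ (Fin 4)).comp (D r)
  have hB : ContinuousAt (fun r => (B r).det) x :=
    ContinuousLinearMap.continuous_det.continuousAt.comp
      ((ContinuousLinearMap.compL ℝ _ _ _
        (κ : (ℂ × ℂ) →L[ℝ] EuclideanSpace ℝ (Fin 4))).continuous.continuousAt.comp hD)
  have hBx (r : X) (hr : r ∈ φ.source) (hr' : r ∈ (chartAt (EuclideanHalfSpace 4) x).source)
      (h : HasMFDerivAt (𝓡∂ 4) 𝓘(ℝ, ℂ × ℂ) φ r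
      ((D r).comp (chartChange (𝓡∂ 4) (achart _ r) (achart _ x) r))) : (B r).det ≠ 0 := by
    have hsurj : Function.Surjective (B r) := by
      intro w
      obtain ⟨v, hv⟩ := hφ.mdifferentiable.mfderiv_surjective hr (κ.symm w)
      refine ⟨chartChange (𝓡∂ 4) (achart _ r) (achart _ x) r v, ?_⟩
      have h1 : D r (chartChange (𝓡∂ 4) (achart _ r) (achart _ x) r v) = κ.symm w := by
        rw [← hv, h.mfderiv]
        rfl
      change κ (D r _) = w
      rw [h1, κ.apply_symm_apply]
    have hinj : Function.Injective (B r).toLinearMap := LinearMap.injective_iff_surjective.2 hsurj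
    exact (LinearEquiv.isUnit_det' (LinearEquiv.ofBijective (B r).toLinearMap
      ⟨hinj, hsurj⟩)).ne_zero
  have hBx0 : (B x).det ≠ 0 := hBx x hx (mem_chart_source _ x) hder.self_of_nhds
  have hsign : ∀ᶠ r in 𝓝 x, (0 < (B r).det ↔ 0 < (B x).det) := by
    rcases lt_or_gt_of_ne hBx0 with h | h
    · filter_upwards [hB.eventually_lt continuousAt_const h] with r hr
      exact ⟨fun h' => absurd h' hr.not_gt, fun h' => absurd h' h.not_gt⟩
    · filter_upwards [continuousAt_const.eventually_lt hB h] with r hr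
      exact ⟨fun _ => h, fun _ => hr⟩
  have hall : ∀ᶠ r in 𝓝 x, r ∈ φ.source → MapsOrientation
      (differentialAt (𝓡∂ 4) φ r).toLinearMap (𝔬.at_point r)
      (Orientation.map (Fin 4) κ.symm.toLinearEquiv (transportOrientation (B x) o)) := by
    filter_upwards [hder, ho, hsign, (chartAt (EuclideanHalfSpace 4) x).open_source.mem_nhds
      (mem_chart_source _ x)] with r h1 h2 h3 h4 hr
    have m1 : MapsOrientation (chartChange (𝓡∂ 4) (achart _ r) (achart _ x) r).toLinearMap
        (𝔬.at_point r : Orientation ℝ (EuclideanSpace ℝ (Fin 4)) (Fin 4)) o :=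
      (mapsOrientation_iff_transportOrientation (chartChange_det_ne_zero _ _ _
        (mem_chart_source _ r) h4)).2 h2
    have m2 : MapsOrientation (B r).toLinearMap o (transportOrientation (B x) o) := by
      refine (mapsOrientation_iff_transportOrientation (hBx r hr h4 h1)).2 ?_
      unfold transportOrientation
      rw [if_congr h3 rfl rfl]
    have m3 : MapsOrientation (κ.symm.toLinearEquiv : EuclideanSpace ℝ (Fin 4) →ₗ[ℝ] ℂ × ℂ)
        (transportOrientation (B x) o)
        (Orientation.map (Fin 4) κ.symm.toLinearEquiv (transportOrientation (B x) o)) :=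
      ⟨_, rfl, rfl⟩
    have m := m3.comp (m2.comp m1)
    have heq : (differentialAt (𝓡∂ 4) φ r).toLinearMap =
        (κ.symm.toLinearEquiv : EuclideanSpace ℝ (Fin 4) →ₗ[ℝ] ℂ × ℂ) ∘ₗ
        (B r).toLinearMap ∘ₗ (chartChange (𝓡∂ 4) (achart _ r) (achart _ x) r).toLinearMap := by
      ext1 v
      unfold differentialAt
      rw [h1.mfderiv]
      exact (κ.symm_apply_apply _).symm
    rw [heq]
    exact m
  obtain ⟨s, hs, hso, hxs⟩ := eventually_nhds_iff.1 hall
  exact ⟨s, hso, _, hxs, fun p hp => hs p hp.2 hp.1⟩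

/-- Every critical point is positive or negative. -/
theorem IsLefschetzFibration.positive_union_negative (hf : IsLefschetzFibration f)
    (𝔬 : ManifoldOrientation (𝓡∂ 4) X) :
    positiveCriticalPoints 𝔬 f ∪ negativeCriticalPoints 𝔬 f =
      criticalPoints (𝓡∂ 4) (𝓡∂ 2) f := by
  have := hf.total.smooth
  apply Subset.antisymm
  · rintro p (hp | hp) <;> exact hp.1
  · intro p hp
    obtain ⟨φ, ψ, h⟩ := hf.critical_chart p hp
    obtain ⟨s, hs, o, hps, ho⟩ := h.smooth_total.exists_chartMapsOrientation h.mem_total 𝔬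
    rcases complexPlane_orientation_eq_or o with rfl | rfl
    · exact Or.inl ⟨hp, _, ψ, h.restrOpen hs hps, ho⟩
    · exact Or.inr ⟨hp, _, ψ, h.restrOpen hs hps, ho⟩

end LocalModel

end

noncomputable section

/-! ### The Lefschetz fibration on the orientation double cover -/

namespace OrientationCover

variable {X S : Type*} [TopologicalSpace X] [ChartedSpace (EuclideanHalfSpace 4) X]
  [IsManifold (𝓡∂ 4) ∞ X] [TopologicalSpace S] [ChartedSpace (EuclideanHalfSpace 2) S] {f : X → S}

theorem criticalPoints_comp_proj (hf : MDifferentiable (𝓡∂ 4) (𝓡∂ 2) f) :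
    criticalPoints (𝓡∂ 4) (𝓡∂ 2) (f ∘ proj (𝓡∂ 4) X) =
      proj (𝓡∂ 4) X ⁻¹' criticalPoints (𝓡∂ 4) (𝓡∂ 2) f := by
  ext q
  have h : mfderiv (𝓡∂ 4) (𝓡∂ 2) (f ∘ proj (𝓡∂ 4) X) q =
      mfderiv (𝓡∂ 4) (𝓡∂ 2) f (proj (𝓡∂ 4) X q) := mfderiv_comp_proj (hf _)
  exact not_congr (iff_of_eq (congrArg
    (fun A : EuclideanSpace ℝ (Fin 4) →L[ℝ] EuclideanSpace ℝ (Fin 2) => Function.Surjective A) h))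

/-- All conditions are local on the total space, except compactness and connectedness; the local
model at `q` is that at `q.point` preceded by the inverse of a local section. -/
theorem isLefschetzFibration_comp_proj (hf : IsLefschetzFibration f)
    (hX : ¬ IsOrientableManifold (𝓡∂ 4) X) :
    IsLefschetzFibration (f ∘ proj (𝓡∂ 4) X) where
  total :=
    have := hf.total.t2
    have := hf.total.compact
    have := hf.total.connected
    { t2 := inferInstance
      compact := compactSpace
      connected := connectedSpace hX
      smooth := instIsManifold }
  base := hf.base
  base_orientable := hf.base_orientable
  smooth := hf.smooth.comp contMDiff_proj
  boundary_eq := by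
    rw [preimage_comp, ← hf.boundary_eq]
    -- Boundary points are detected in the preferred chart, which on the cover is that of the base
    -- point.
    rfl
  critical_interior := by
    rw [criticalPoints_comp_proj (hf.smooth.mdifferentiable (by simp))]
    intro q hq
    exact hf.critical_interior hq
  critical_chart q hq := by
    rw [criticalPoints_comp_proj (hf.smooth.mdifferentiable (by simp))] at hq
    obtain ⟨φ, ψ, h⟩ := hf.critical_chart _ hq
    have hs := mem_sheet_source_self q
    exact ⟨_, ψ, h.trans_left (contMDiffOn_localProj (achart _ q.point) q.modelOrientation)
      (contMDiffOn_localProj_symm _ _) (by rwa [localProj_source]) (localProj_apply hs)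
      fun z hz => by
        rw [localProj_source] at hz
        exact congrArg f (localProj_apply hz).symm⟩

/-- The map `f ∘ proj` is invariant under the deck map, so the base chart stays the same. -/
theorem chartPair_deck {q : OrientationCover (𝓡∂ 4) X}
    {φ : OpenPartialHomeomorph (OrientationCover (𝓡∂ 4) X) (ℂ × ℂ)}
    {ψ : OpenPartialHomeomorph S ℂ}
    (h : IsLefschetzChartPair (f ∘ proj (𝓡∂ 4) X) q φ ψ) :
    IsLefschetzChartPair (f ∘ proj (𝓡∂ 4) X) (deck q)
      (deckHomeomorph.toOpenPartialHomeomorph.trans φ) ψ :=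
  h.trans_left contMDiff_deck.contMDiffOn contMDiff_deck.contMDiffOn (mem_univ _) (deck_deck q)
    fun _ _ => rfl

/-- The deck map has identity differential in the model space while `𝔬` changes sign along it, so
the chart now lands in the opposite orientation. -/
theorem chartMapsOrientation_deck [ConnectedSpace (OrientationCover (𝓡∂ 4) X)]
    {𝔬 : ManifoldOrientation (𝓡∂ 4) (OrientationCover (𝓡∂ 4) X)}
    {φ : OpenPartialHomeomorph (OrientationCover (𝓡∂ 4) X) (ℂ × ℂ)}
    (hφ : IsSmoothChart (𝓡∂ 4) φ) {o : Orientation ℝ (ℂ × ℂ) (Fin 4)}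
    (h : ChartMapsOrientation 𝔬 φ o) :
    ChartMapsOrientation 𝔬 (deckHomeomorph.toOpenPartialHomeomorph.trans φ) (-o) := by
  intro p hp
  have hp' : deck p ∈ φ.source := hp.2
  have h1 := (h _ hp').neg
  have h2 : differentialAt (𝓡∂ 4) (φ ∘ deck) p = differentialAt (𝓡∂ 4) φ (deck p) := by
    unfold differentialAt
    refine (((hφ.mdifferentiable.mdifferentiableAt hp').hasMFDerivAt.comp p
      (hasMFDerivAt_deck p)).mfderiv).trans ?_
    ext1 v
    rfl
  have h3 : (𝔬.at_point p : Orientation ℝ (EuclideanSpace ℝ (Fin 4)) (Fin 4)) =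
      -𝔬.at_point (deck p) := by
    rw [at_point_deck]
    exact (neg_neg (𝔬.at_point p)).symm
  change MapsOrientation (differentialAt (𝓡∂ 4) (φ ∘ deck) p).toLinearMap _ _
  rw [h2, h3]
  exact h1

theorem mapsTo_deck_positive [ConnectedSpace (OrientationCover (𝓡∂ 4) X)]
    (hf : MDifferentiable (𝓡∂ 4) (𝓡∂ 2) f)
    (𝔬 : ManifoldOrientation (𝓡∂ 4) (OrientationCover (𝓡∂ 4) X)) :
    MapsTo deck (positiveCriticalPoints 𝔬 (f ∘ proj (𝓡∂ 4) X))
      (negativeCriticalPoints 𝔬 (f ∘ proj (𝓡∂ 4) X)) := by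
  rintro q ⟨hq, φ, ψ, h, ho⟩
  refine ⟨?_, _, ψ, chartPair_deck h, chartMapsOrientation_deck h.smooth_total ho⟩
  rwa [criticalPoints_comp_proj hf] at hq ⊢

theorem mapsTo_deck_negative [ConnectedSpace (OrientationCover (𝓡∂ 4) X)]
    (hf : MDifferentiable (𝓡∂ 4) (𝓡∂ 2) f)
    (𝔬 : ManifoldOrientation (𝓡∂ 4) (OrientationCover (𝓡∂ 4) X)) :
    MapsTo deck (negativeCriticalPoints 𝔬 (f ∘ proj (𝓡∂ 4) X))
      (positiveCriticalPoints 𝔬 (f ∘ proj (𝓡∂ 4) X)) := by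
  rintro q ⟨hq, φ, ψ, h, ho⟩
  refine ⟨?_, _, ψ, chartPair_deck h, ?_⟩
  · rwa [criticalPoints_comp_proj hf] at hq ⊢
  · have := chartMapsOrientation_deck h.smooth_total ho
    have e : - -complexPlaneOrientation = complexPlaneOrientation :=
      neg_neg complexPlaneOrientation
    rwa [e] at this

/-- The deck involution maps each of the two sets onto the other. -/
theorem ncard_positive_eq_ncard_negative [ConnectedSpace (OrientationCover (𝓡∂ 4) X)]
    (hf : MDifferentiable (𝓡∂ 4) (𝓡∂ 2) f)
    (𝔬 : ManifoldOrientation (𝓡∂ 4) (OrientationCover (𝓡∂ 4) X)) :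
    (positiveCriticalPoints 𝔬 (f ∘ proj (𝓡∂ 4) X)).ncard =
      (negativeCriticalPoints 𝔬 (f ∘ proj (𝓡∂ 4) X)).ncard := by
  have h : deck '' positiveCriticalPoints 𝔬 (f ∘ proj (𝓡∂ 4) X) =
      negativeCriticalPoints 𝔬 (f ∘ proj (𝓡∂ 4) X) :=
    Subset.antisymm (mapsTo_deck_positive hf 𝔬).image_subset fun q hq =>
      ⟨deck q, mapsTo_deck_negative hf 𝔬 hq, deck_deck q⟩
  rw [← h]
  exact (ncard_image_of_injective _ (Function.LeftInverse.injective deck_deck)).symm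

theorem isAchiral_comp_proj (hf : IsLefschetzFibration f) (hX : ¬ IsOrientableManifold (𝓡∂ 4) X)
    (𝔬 : ManifoldOrientation (𝓡∂ 4) (OrientationCover (𝓡∂ 4) X))
    (hc : (criticalPoints (𝓡∂ 4) (𝓡∂ 2) f).Nonempty) : IsAchiral 𝔬 (f ∘ proj (𝓡∂ 4) X) := by
  have hL := isLefschetzFibration_comp_proj hf hX
  have := hL.total.connected
  have hd : MDifferentiable (𝓡∂ 4) (𝓡∂ 2) f := hf.smooth.mdifferentiable (by simp)
  obtain ⟨x, hx⟩ := hc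
  let q : OrientationCover (𝓡∂ 4) X :=
    ⟨x, (EuclideanSpace.basisFun (Fin 4) ℝ).toBasis.orientation⟩
  have hq : q ∈ criticalPoints (𝓡∂ 4) (𝓡∂ 2) (f ∘ proj (𝓡∂ 4) X) := by
    rw [criticalPoints_comp_proj hd]
    exact hx
  rw [← hL.positive_union_negative 𝔬] at hq
  rcases hq with hq | hq
  · exact ⟨_, mapsTo_deck_positive hd 𝔬 hq⟩
  · exact ⟨_, hq⟩

end OrientationCover

end

noncomputable section

/-! ### The model surfaces -/

/-- The centres of the holes are symmetric about `0`: reflection exchanges `i` and `g - 1 - i`. -/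
theorem holedDisc_neg (g : ℕ) (x y : ℝ) : holedDisc g (-x) (-y) = holedDisc g x y := by
  unfold holedDisc
  congr 1
  · ring
  · rw [← Finset.prod_range_reflect]
    refine Finset.prod_congr rfl fun i hi => ?_
    have hi' : i + 1 ≤ g := Finset.mem_range.1 hi
    rw [show g - 1 - i = g - (i + 1) by omega, Nat.cast_sub hi']
    push_cast
    ring

/-- A point at distance `R` from the origin is at distance at least `R - |c| ≥ 2` from `(c, 0)`. -/
theorem circle_disjoint_outer {R c x y : ℝ} (hR : 2 ≤ R) (h1 : c ≤ R - 2) (h2 : -(R - 2) ≤ c)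
    (hx : R ^ 2 - x ^ 2 - y ^ 2 = 0) : (x - c) ^ 2 + y ^ 2 - 1 ≠ 0 := by
  intro h
  have hxR : x ≤ R := by nlinarith [sq_nonneg y]
  have hxR' : -R ≤ x := by nlinarith [sq_nonneg y]
  rcases le_total 0 c with hc | hc
  · nlinarith [mul_le_mul_of_nonneg_right hxR hc]
  · nlinarith [mul_le_mul_of_nonneg_right hxR' (neg_nonneg.2 hc)]

theorem circle_disjoint {c c' x y : ℝ} (hc : 4 ≤ |c - c'|) (hx : (x - c) ^ 2 + y ^ 2 - 1 = 0) :
    (x - c') ^ 2 + y ^ 2 - 1 ≠ 0 := by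
  intro h
  have h1 : |x - c| ≤ 1 := abs_le_one_iff_mul_self_le_one.2 (by nlinarith [sq_nonneg y])
  have h2 : |x - c'| ≤ 1 := abs_le_one_iff_mul_self_le_one.2 (by nlinarith [sq_nonneg y])
  have h3 := abs_sub_le c x c'
  rw [abs_sub_comm c x] at h3
  linarith

/-- The surface `Σ_g` is the zero set of this function. -/
def surfaceFunction (g : ℕ) (p : EuclideanSpace ℝ (Fin 3)) : ℝ :=
  p 2 ^ 2 - holedDisc g (p 0) (p 1)

theorem mem_orientableSurface_iff {g : ℕ} {p : EuclideanSpace ℝ (Fin 3)} :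
    p ∈ orientableSurface g ↔ surfaceFunction g p = 0 := by
  rw [surfaceFunction, sub_eq_zero]
  rfl

theorem surfaceFunction_neg (g : ℕ) (p : EuclideanSpace ℝ (Fin 3)) :
    surfaceFunction g (-p) = surfaceFunction g p := by
  simp [surfaceFunction, holedDisc_neg]

theorem neg_mem_orientableSurface {g : ℕ} {p : EuclideanSpace ℝ (Fin 3)}
    (h : p ∈ orientableSurface g) : -p ∈ orientableSurface g := by
  rw [mem_orientableSurface_iff] at h ⊢
  rw [surfaceFunction_neg, h]

theorem contDiff_surfaceFunction (g : ℕ) : ContDiff ℝ ∞ (surfaceFunction g) := by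
  unfold surfaceFunction holedDisc
  have h (i : Fin 3) : ContDiff ℝ ∞ fun p : EuclideanSpace ℝ (Fin 3) => p i :=
    (EuclideanSpace.proj i : EuclideanSpace ℝ (Fin 3) →L[ℝ] ℝ).contDiff
  refine ((h 2).pow 2).sub (((contDiff_const.sub ((h 0).pow 2)).sub ((h 1).pow 2)).mul ?_)
  exact contDiff_prod fun i _ => ((((h 0).sub contDiff_const).pow 2).add ((h 1).pow 2)).sub
    contDiff_const

/-- Parity: the centres of the holes are even integers, so none of them is at distance `1` from the
origin. -/
theorem zero_notMem_orientableSurface (g : ℕ) :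
    (0 : EuclideanSpace ℝ (Fin 3)) ∉ orientableSurface g := by
  rw [mem_orientableSurface_iff, surfaceFunction, holedDisc]
  simp only [PiLp.zero_apply]
  intro h
  have h' : ((2 * g + 1 : ℝ) ^ 2) * ∏ i ∈ Finset.range g,
      ((4 * (i : ℝ) - 2 * (g - 1)) ^ 2 - 1) = 0 := by
    rw [Finset.prod_congr rfl fun (i : ℕ) _ => show ((0 - (4 * (i : ℝ) - 2 * (g - 1))) ^ 2 + 0 ^ 2 - 1) =
      (4 * (i : ℝ) - 2 * (g - 1)) ^ 2 - 1 by ring] at h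
    linear_combination -h
  rcases mul_eq_zero.1 h' with h1 | h1
  · have : (0 : ℝ) < (2 * g + 1) ^ 2 := by positivity
    exact this.ne' h1
  · obtain ⟨i, -, hi⟩ := Finset.prod_eq_zero_iff.1 h1
    have h2 : ((4 * (i : ℤ) - 2 * (g - 1)) ^ 2 - 1 : ℤ) = 0 := by exact_mod_cast hi
    have h3 : (2 : ℤ) * (2 * (2 * (i : ℤ) - (g - 1)) ^ 2) = 1 := by linear_combination h2
    omega

theorem hasDerivAt_mul_of_eq_zero {u v : ℝ → ℝ} {u' s : ℝ} (hu : HasDerivAt u u' s)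
    (h0 : u s = 0) (hv : DifferentiableAt ℝ v s) :
    HasDerivAt (fun t => u t * v t) (u' * v s) s := by
  have := hu.mul hv.hasDerivAt
  rwa [h0, zero_mul, add_zero] at this

/-- At a boundary point of the holed disc, the polynomial has a nonzero directional derivative. -/
theorem exists_hasDerivAt_holedDisc_ne_zero {g : ℕ} {x y : ℝ} (h : holedDisc g x y = 0) :
    ∃ a b d : ℝ, d ≠ 0 ∧ HasDerivAt (fun t => holedDisc g (x + t * a) (y + t * b)) d 0 := by
  have hl (a c : ℝ) : HasDerivAt (fun t : ℝ => c + t * a) a 0 := by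
    simpa using ((hasDerivAt_id (0 : ℝ)).mul_const a).const_add c
  have hA (a b : ℝ) : HasDerivAt (fun t : ℝ => (2 * g + 1 : ℝ) ^ 2 - (x + t * a) ^ 2 -
      (y + t * b) ^ 2) (-(2 * (x * a)) - 2 * (y * b)) 0 := by
    have := (((hl a x).pow 2).const_sub ((2 * g + 1 : ℝ) ^ 2)).sub ((hl b y).pow 2)
    refine this.congr_deriv ?_
    simp
    ring
  have hB (c a b : ℝ) : HasDerivAt (fun t : ℝ => (x + t * a - c) ^ 2 + (y + t * b) ^ 2 - 1)
      (2 * ((x - c) * a) + 2 * (y * b)) 0 := by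
    have := ((((hl a x).sub_const c).pow 2).add ((hl b y).pow 2)).sub_const 1
    refine this.congr_deriv ?_
    simp
    ring
  have hP (s : Finset ℕ) (a b : ℝ) : DifferentiableAt ℝ (fun t : ℝ => ∏ i ∈ s,
      ((x + t * a - (4 * i - 2 * (g - 1))) ^ 2 + (y + t * b) ^ 2 - 1)) 0 := by
    fun_prop
  have hbd (i : ℕ) (hi : i ∈ Finset.range g) : (4 * i - 2 * (g - 1) : ℝ) ≤ (2 * g + 1) - 2 ∧
      -((2 * g + 1) - 2) ≤ (4 * i - 2 * (g - 1) : ℝ) := by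
    have h1 : ((i + 1 : ℕ) : ℝ) ≤ g := Nat.cast_le.2 (Finset.mem_range.1 hi)
    have h2 : (0 : ℝ) ≤ i := i.cast_nonneg
    push_cast at h1
    constructor <;> linarith
  have hR (i : ℕ) (hi : i ∈ Finset.range g) : (2 : ℝ) ≤ 2 * g + 1 := by
    have h1 : ((1 : ℕ) : ℝ) ≤ g := Nat.cast_le.2 (by have := Finset.mem_range.1 hi; omega)
    push_cast at h1
    linarith
  rcases mul_eq_zero.1 h with h1 | h1
  · have hne : ∏ i ∈ Finset.range g, ((x - (4 * i - 2 * (g - 1))) ^ 2 + y ^ 2 - 1) ≠ 0 :=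
      Finset.prod_ne_zero_iff.2 fun i hi =>
        circle_disjoint_outer (hR i hi) (hbd i hi).1 (hbd i hi).2 h1
    -- On the outer circle the radial direction is used: the vanishing factor has derivative `-2 (2g
    -- + 1)²`.
    refine ⟨x, y, _, ?_, hasDerivAt_mul_of_eq_zero (hA x y) (by simpa using h1) (hP _ x y)⟩
    simp only [zero_mul, add_zero]
    refine mul_ne_zero ?_ hne
    have : (0 : ℝ) < (2 * g + 1) ^ 2 := by positivity
    nlinarith
  · obtain ⟨j, hj, hj0⟩ := Finset.prod_eq_zero_iff.1 h1
    have hne : ∏ i ∈ (Finset.range g).erase j,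
        ((x - (4 * i - 2 * (g - 1))) ^ 2 + y ^ 2 - 1) ≠ 0 := by
      refine Finset.prod_ne_zero_iff.2 fun i hi => circle_disjoint ?_ hj0
      have hij : i ≠ j := (Finset.mem_erase.1 hi).1
      have h2 : (1 : ℤ) ≤ |(j : ℤ) - i| := Int.one_le_abs (by omega)
      have h3 : (1 : ℝ) ≤ |(j : ℝ) - i| := by exact_mod_cast h2
      rw [show (4 * j - 2 * (g - 1) - (4 * i - 2 * (g - 1)) : ℝ) = 4 * (j - i) by ring, abs_mul]
      norm_num
      linarith
    have hA0 : (2 * g + 1 : ℝ) ^ 2 - x ^ 2 - y ^ 2 ≠ 0 := fun h0 =>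
      circle_disjoint_outer (hR j hj) (hbd j hj).1 (hbd j hj).2 h0 hj0
    have hd := hasDerivAt_mul_of_eq_zero (hB (4 * j - 2 * (g - 1)) (x - (4 * j - 2 * (g - 1))) y)
      (by simpa using hj0) ((hA (x - (4 * j - 2 * (g - 1))) y).differentiableAt.mul
        (hP ((Finset.range g).erase j) (x - (4 * j - 2 * (g - 1))) y))
    -- Radial direction from the centre of hole `j`, in which its own factor has derivative `2`.
    refine ⟨x - (4 * j - 2 * (g - 1)), y, _, ?_, hd.congr_of_eventuallyEq (Eventually.of_forall fun t => ?_)⟩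
    · simp only [Pi.mul_apply, zero_mul, add_zero]
      refine mul_ne_zero ?_ (mul_ne_zero hA0 hne)
      nlinarith
    · simp only [holedDisc, Pi.mul_apply]
      rw [← Finset.mul_prod_erase _ _ hj]
      ring

theorem hasStrictFDerivAt_surfaceFunction (g : ℕ) (p : EuclideanSpace ℝ (Fin 3)) :
    HasStrictFDerivAt (surfaceFunction g) (fderiv ℝ (surfaceFunction g) p) p :=
  (contDiff_surfaceFunction g).contDiffAt.hasStrictFDerivAt (by simp)

/-- Zero is a regular value of the function defining `Σ_g`. -/
theorem fderiv_surfaceFunction_ne_zero {g : ℕ} {p : EuclideanSpace ℝ (Fin 3)}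
    (hp : p ∈ orientableSurface g) : fderiv ℝ (surfaceFunction g) p ≠ 0 := by
  intro h0
  have hd := (hasStrictFDerivAt_surfaceFunction g p).hasFDerivAt
  rw [h0] at hd
  have hline (w : EuclideanSpace ℝ (Fin 3)) :
      HasDerivAt (fun t : ℝ => surfaceFunction g (p + t • w)) 0 0 := by
    have h1 : HasDerivAt (fun t : ℝ => p + t • w) w 0 := by
      simpa using ((hasDerivAt_id (0 : ℝ)).smul_const w).const_add p
    have hd' : HasFDerivAt (surfaceFunction g) (0 : EuclideanSpace ℝ (Fin 3) →L[ℝ] ℝ)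
        ((fun t : ℝ => p + t • w) 0) := by simpa using hd
    simpa [Function.comp_def] using hd'.comp_hasDerivAt (0 : ℝ) h1
  have hl (a c : ℝ) : HasDerivAt (fun t : ℝ => c + t * a) a 0 := by
    simpa using ((hasDerivAt_id (0 : ℝ)).mul_const a).const_add c
  -- The partial derivative in the third coordinate is `2 p 2`, so a degenerate point would lie over
  -- the boundary of the holed disc.
  have hz : p 2 = 0 := by
    have h1 := hline (EuclideanSpace.single 2 1)
    have h2 : HasDerivAt (fun t : ℝ => surfaceFunction g (p + t • EuclideanSpace.single 2 1))
        (2 * p 2) 0 := by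
      refine ((((hl 1 (p 2)).pow 2).sub_const (holedDisc g (p 0) (p 1))).congr_deriv
        (by simp)).congr_of_eventuallyEq (Eventually.of_forall fun t => ?_)
      simp [surfaceFunction]
    have := h1.unique h2
    linarith
  have hh : holedDisc g (p 0) (p 1) = 0 := by
    have : p 2 ^ 2 = holedDisc g (p 0) (p 1) := hp
    rw [← this, hz]
    simp
  obtain ⟨a, b, d, hd0, hder⟩ := exists_hasDerivAt_holedDisc_ne_zero hh
  have h1 := hline !₂[a, b, 0]
  have h2 : HasDerivAt (fun t : ℝ => surfaceFunction g (p + t • !₂[a, b, 0])) (-d) 0 := by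
    refine hder.neg.congr_of_eventuallyEq (Eventually.of_forall fun t => ?_)
    simp [surfaceFunction, hz]
  exact hd0 (neg_eq_zero.1 (h2.unique h1))

/-- The implicit function parametrizes the surface by the kernel of the differential, its own
derivative being the inclusion. Consequently derivatives within the surface are determined on this
kernel. -/
theorem mem_tangentConeAt_orientableSurface {g : ℕ} {p w : EuclideanSpace ℝ (Fin 3)}
    (hp : p ∈ orientableSurface g) (hw : fderiv ℝ (surfaceFunction g) p w = 0) :
    w ∈ tangentConeAt ℝ (orientableSurface g) p := by
  have hs := hasStrictFDerivAt_surfaceFunction g p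
  have hr : (fderiv ℝ (surfaceFunction g) p).range = ⊤ := by
    refine LinearMap.range_eq_top.2 (LinearMap.surjective ?_)
    intro h
    exact fderiv_surfaceFunction_ne_zero hp (ContinuousLinearMap.coe_injective h)
  have hd := hs.to_implicitFunction hr
  have h0 : hs.implicitFunction _ _ hr (surfaceFunction g p) 0 = p :=
    hs.implicitFunction_apply_image hr
  have hU : ∀ᶠ v in 𝓝 (0 : (fderiv ℝ (surfaceFunction g) p).ker),
      hs.implicitFunction _ _ hr (surfaceFunction g p) v ∈ orientableSurface g := by
    have := hs.map_implicitFunction_eq hr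
    have h2 : Tendsto (fun v : (fderiv ℝ (surfaceFunction g) p).ker => (surfaceFunction g p, v))
        (𝓝 0) (𝓝 (surfaceFunction g p, 0)) := (Continuous.prodMk_right _).tendsto 0
    filter_upwards [h2.eventually this] with v hv
    rw [mem_orientableSurface_iff, hv]
    exact mem_orientableSurface_iff.1 hp
  have hmaps := (hd.hasFDerivAt.hasFDerivWithinAt (s := {v | hs.implicitFunction _ _ hr
    (surfaceFunction g p) v ∈ orientableSurface g})).mapsTo_tangent_cone
  have hmem : (⟨w, hw⟩ : (fderiv ℝ (surfaceFunction g) p).ker) ∈ tangentConeAt ℝ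
      {v | hs.implicitFunction _ _ hr (surfaceFunction g p) v ∈ orientableSurface g} 0 := by
    rw [tangentConeAt_of_mem_nhds hU]
    trivial
  have h3 := hmaps hmem
  rw [h0] at h3
  refine tangentConeAt_mono ?_ h3
  rintro _ ⟨v, hv, rfl⟩
  exact hv

end

noncomputable section

/-! ### Frames: orienting a four-dimensional space by a surjection to the plane and a map to space -/

section Frame

local notation "E2" => EuclideanSpace ℝ (Fin 2)
local notation "E3" => EuclideanSpace ℝ (Fin 3)
local notation "E4" => EuclideanSpace ℝ (Fin 4)

/-- The linear map `(v, t) ↦ (A v, B v + t z)`. -/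
def frameMap (A : E4 →L[ℝ] E2) (B : E4 →L[ℝ] E3) (z : E3) : (E4 × ℝ) →L[ℝ] (E2 × E3) :=
  (ContinuousLinearMap.inl ℝ E2 E3).comp (A.comp (ContinuousLinearMap.fst ℝ E4 ℝ)) +
    (ContinuousLinearMap.inr ℝ E2 E3).comp (B.comp (ContinuousLinearMap.fst ℝ E4 ℝ) +
      (ContinuousLinearMap.snd ℝ E4 ℝ).smulRight z)

theorem frameMap_apply (A : E4 →L[ℝ] E2) (B : E4 →L[ℝ] E3) (z : E3) (v : E4 × ℝ) :
    frameMap A B z v = (A v.1, B v.1 + v.2 • z) := by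
  simp [frameMap]

/-- A linear identification used to form determinants. -/
def frameEquiv : (E2 × E3) ≃L[ℝ] (E4 × ℝ) :=
  ContinuousLinearEquiv.ofFinrankEq (by simp [Module.finrank_prod])

/-- The determinant of the map `(v, t) ↦ (A v, B v + t z)`. -/
def frameDet (A : E4 →L[ℝ] E2) (B : E4 →L[ℝ] E3) (z : E3) : ℝ :=
  LinearMap.det (frameEquiv.toLinearEquiv.toLinearMap ∘ₗ (frameMap A B z).toLinearMap)

/-- Used with `C` a chart change: the sign of `frameDet` transforms like an orientation. -/
theorem frameDet_comp (A : E4 →L[ℝ] E2) (B : E4 →L[ℝ] E3) (z : E3) (C : E4 →L[ℝ] E4) :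
    frameDet (A.comp C) (B.comp C) z = frameDet A B z * C.det := by
  have h : frameEquiv.toLinearEquiv.toLinearMap ∘ₗ
      (frameMap (A.comp C) (B.comp C) z).toLinearMap =
      (frameEquiv.toLinearEquiv.toLinearMap ∘ₗ (frameMap A B z).toLinearMap) ∘ₗ
        LinearMap.prodMap C.toLinearMap LinearMap.id := by
    refine LinearMap.ext fun v => ?_
    change frameEquiv (frameMap _ _ _ v) = frameEquiv (frameMap _ _ _ (C v.1, v.2))
    rw [frameMap_apply, frameMap_apply]
    rfl
  rw [frameDet, h, LinearMap.det_comp, LinearMap.det_prodMap, LinearMap.det_id, mul_one]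
  rfl

theorem frameDet_of_comp_left {A A' : E4 →L[ℝ] E2} {B B' : E4 →L[ℝ] E3} {z z' : E3}
    (P : (E2 × E3) →ₗ[ℝ] (E2 × E3)) (h : ∀ v, frameMap A' B' z' v = P (frameMap A B z v)) :
    frameDet A' B' z' = LinearMap.det P * frameDet A B z := by
  have h1 : frameEquiv.toLinearEquiv.toLinearMap ∘ₗ (frameMap A' B' z').toLinearMap =
      (frameEquiv.toLinearEquiv.toLinearMap ∘ₗ P ∘ₗ frameEquiv.toLinearEquiv.symm.toLinearMap) ∘ₗ
      (frameEquiv.toLinearEquiv.toLinearMap ∘ₗ (frameMap A B z).toLinearMap) := by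
    refine LinearMap.ext fun v => ?_
    change frameEquiv (frameMap _ _ _ v) = frameEquiv (P (frameEquiv.symm (frameEquiv
      (frameMap _ _ _ v))))
    rw [h, frameEquiv.symm_apply_apply]
  rw [frameDet, h1, LinearMap.det_comp]
  congr 1
  exact LinearMap.det_conj P frameEquiv.toLinearEquiv

/-- Only the three-dimensional factor is negated, and `(-1)³ = -1`. This is why antipodal points
give opposite orientations. -/
theorem frameDet_neg (A : E4 →L[ℝ] E2) (B : E4 →L[ℝ] E3) (z : E3) :
    frameDet A (-B) (-z) = -frameDet A B z := by
  rw [frameDet_of_comp_left (A := A) (B := B) (z := z)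
    (LinearMap.prodMap LinearMap.id (-LinearMap.id)) fun v => ?_]
  · rw [LinearMap.det_prodMap, LinearMap.det_id, one_mul, ← neg_one_smul ℝ (LinearMap.id),
      LinearMap.det_smul]
    simp
    norm_num
  · rw [frameMap_apply, frameMap_apply]
    simp [add_comm]

theorem frameDet_ne_zero {A : E4 →L[ℝ] E2} {B : E4 →L[ℝ] E3} {z : E3}
    (h : ∀ (v : E4) (t : ℝ), A v = 0 → B v + t • z = 0 → v = 0 ∧ t = 0) : frameDet A B z ≠ 0 := by
  have hinj : Function.Injective
      (frameEquiv.toLinearEquiv.toLinearMap ∘ₗ (frameMap A B z).toLinearMap) := by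
    refine LinearMap.ker_eq_bot.1 (LinearMap.ker_eq_bot'.2 fun v hv => ?_)
    have hv' : frameMap A B z v = 0 := frameEquiv.map_eq_zero_iff.1 hv
    rw [frameMap_apply] at hv'
    obtain ⟨h1, h2⟩ := h v.1 v.2 (congrArg Prod.fst hv') (congrArg Prod.snd hv')
    exact Prod.ext h1 h2
  exact (LinearEquiv.isUnit_det' (LinearEquiv.ofInjectiveEndo _ hinj)).ne_zero

/-- Determinants of shears are positive. -/
theorem det_shear_pos (E : E2 →ₗ[ℝ] E3) :
    0 < LinearMap.det ((LinearMap.fst ℝ E2 E3).prod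
      (E ∘ₗ LinearMap.fst ℝ E2 E3 + LinearMap.snd ℝ E2 E3)) := by
  let P (E : E2 →ₗ[ℝ] E3) : (E2 × E3) →ₗ[ℝ] (E2 × E3) :=
    (LinearMap.fst ℝ E2 E3).prod (E ∘ₗ LinearMap.fst ℝ E2 E3 + LinearMap.snd ℝ E2 E3)
  have hadd (E E' : E2 →ₗ[ℝ] E3) : P E ∘ₗ P E' = P (E + E') := by
    refine LinearMap.ext fun v => Prod.ext rfl ?_
    change E v.1 + (E' v.1 + v.2) = (E v.1 + E' v.1) + v.2
    abel
  -- A shear is the square of the half shear, so its determinant is a square, and it is nonzero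
  -- since shears are invertible.
  have hhalf : P E = P ((1 / 2 : ℝ) • E) ∘ₗ P ((1 / 2 : ℝ) • E) := by
    rw [hadd, ← add_smul]
    norm_num
  have hid : P E ∘ₗ P (-E) = LinearMap.id := by
    rw [hadd, add_neg_cancel]
    refine LinearMap.ext fun v => Prod.ext rfl ?_
    change (0 : E3) + v.2 = v.2
    rw [zero_add]
  have hne : LinearMap.det (P E) ≠ 0 := by
    have := congrArg LinearMap.det hid
    rw [LinearMap.det_comp, LinearMap.det_id] at this
    exact left_ne_zero_of_mul_eq_one this
  change 0 < LinearMap.det (P E)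
  rw [hhalf, LinearMap.det_comp] at hne ⊢
  exact lt_of_le_of_ne (mul_self_nonneg _) hne.symm

/-- The difference `B' - B` vanishes on the kernel of `A`, so it factors through `A` and alters the
frame by a shear. This absorbs the ambiguity of a derivative taken only along the fibre. -/
theorem frameDet_pos_iff_of_eqOn_ker {A : E4 →L[ℝ] E2} (hA : Function.Surjective A)
    {B B' : E4 →L[ℝ] E3} (z : E3) (h : ∀ v, A v = 0 → B' v = B v) :
    0 < frameDet A B' z ↔ 0 < frameDet A B z := by
  obtain ⟨R, hR⟩ := A.toLinearMap.exists_rightInverse_of_surjective (LinearMap.range_eq_top.2 hA)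
  have hAR (w : E2) : A (R w) = w := LinearMap.congr_fun hR w
  rw [frameDet_of_comp_left (A := A) (B := B) (z := z) ((LinearMap.fst ℝ E2 E3).prod
    ((B' - B).toLinearMap ∘ₗ R ∘ₗ LinearMap.fst ℝ E2 E3 + LinearMap.snd ℝ E2 E3)) fun v => ?_]
  · exact mul_pos_iff_of_pos_left (det_shear_pos ((B' - B).toLinearMap ∘ₗ R))
  · rw [frameMap_apply, frameMap_apply]
    refine Prod.ext rfl ?_
    change B' v.1 + v.2 • z = (B' (R (A v.1)) - B (R (A v.1))) + (B v.1 + v.2 • z)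
    have h1 := h (v.1 - R (A v.1)) (by rw [map_sub, hAR, sub_self])
    rw [map_sub, map_sub, sub_eq_sub_iff_add_eq_add] at h1
    rw [sub_add_eq_add_sub, eq_sub_iff_add_eq, ← add_assoc, add_right_comm, h1]
    abel

theorem continuous_frameDet : Continuous fun a : (E4 →L[ℝ] E2) × (E4 →L[ℝ] E3) × E3 =>
    frameDet a.1 a.2.1 a.2.2 := by
  have h : Continuous fun a : (E4 →L[ℝ] E2) × (E4 →L[ℝ] E3) × E3 =>
      (frameEquiv : (E2 × E3) →L[ℝ] (E4 × ℝ)).comp (frameMap a.1 a.2.1 a.2.2) := by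
    unfold frameMap
    refine continuous_const.clm_comp (Continuous.add ?_ ?_)
    · exact continuous_const.clm_comp (continuous_fst.clm_comp continuous_const)
    · refine continuous_const.clm_comp (Continuous.add ?_ ?_)
      · exact continuous_snd.fst.clm_comp continuous_const
      · exact (ContinuousLinearMap.smulRightL ℝ (E4 × ℝ) E3
          (ContinuousLinearMap.snd ℝ E4 ℝ)).continuous.comp continuous_snd.snd
  exact ContinuousLinearMap.continuous_det.comp h

/-! ### The antipodal quotient map -/

/-- The map `(p, m) ↦ m p`, from vectors and matrices to vectors. -/
def contraction : E3 →L[ℝ] (Fin 3 → Fin 3 → ℝ) →L[ℝ] E3 :=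
  LinearMap.toContinuousLinearMap
    ((LinearMap.toContinuousLinearMap (𝕜 := ℝ) (E := Fin 3 → Fin 3 → ℝ) (F' := E3)).toLinearMap ∘ₗ
      LinearMap.mk₂ ℝ (fun (p : E3) (m : Fin 3 → Fin 3 → ℝ) =>
        (WithLp.toLp 2 fun i => ∑ j, m i j * p j : E3))
      (fun p p' m => by ext i; simp [mul_add, Finset.sum_add_distrib])
      (fun c p m => by ext i; simp [Finset.mul_sum, mul_left_comm])
      (fun p m m' => by ext i; simp [add_mul, Finset.sum_add_distrib])
      (fun c p m => by ext i; simp [Finset.mul_sum, mul_assoc]))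

theorem contraction_apply (p : E3) (m : Fin 3 → Fin 3 → ℝ) (i : Fin 3) :
    contraction p m i = ∑ j, m i j * p j := rfl

theorem contraction_antipodalQuotient (p q : E3) :
    contraction q (antipodalQuotient p) = inner ℝ p q • p := by
  ext i
  simp [contraction_apply, antipodalQuotient, PiLp.inner_apply, Fin.sum_univ_three]
  ring

theorem antipodalQuotient_neg (p : E3) : antipodalQuotient (-p) = antipodalQuotient p := by
  funext i j
  simp [antipodalQuotient]

theorem eq_or_eq_neg_of_antipodalQuotient_eq {p q : E3} (hp : p ≠ 0)
    (h : antipodalQuotient p = antipodalQuotient q) : q = p ∨ q = -p := by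
  obtain ⟨i, hi⟩ : ∃ i, p i ≠ 0 := by
    by_contra! h0
    exact hp (PiLp.ext h0)
  have hij (j : Fin 3) : p i * p j = q i * q j := congrFun (congrFun h i) j
  rcases mul_self_eq_mul_self_iff.1 (hij i) with h1 | h1
  · left
    ext j
    have := hij j
    rw [h1] at this hi
    exact (mul_left_cancel₀ hi this).symm
  · right
    ext j
    have := hij j
    rw [show q i = -p i by rw [h1, neg_neg]] at this
    have h2 : p i * p j = p i * (-q j) := by rw [this]; ring
    rw [PiLp.neg_apply, mul_left_cancel₀ hi h2, neg_neg]

theorem contDiff_antipodalQuotient : ContDiff ℝ ∞ antipodalQuotient := by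
  have h (i : Fin 3) : ContDiff ℝ ∞ fun p : E3 => p i :=
    (EuclideanSpace.proj i : E3 →L[ℝ] ℝ).contDiff
  exact contDiff_pi.2 fun i => contDiff_pi.2 fun j => (h i).mul (h j)

/-- The derivative of `p ↦ p pᵀ` at `p`, contracted with `p`. -/
def contractedDerivative (p w : E3) : E3 := inner ℝ p p • w + inner ℝ p w • p

theorem contraction_fderiv_antipodalQuotient (p w : E3) :
    contraction p (fderiv ℝ antipodalQuotient p w) = contractedDerivative p w := by
  have h (i : Fin 3) : HasFDerivAt (fun p : E3 => p i) (EuclideanSpace.proj i : E3 →L[ℝ] ℝ) p :=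
    (EuclideanSpace.proj i : E3 →L[ℝ] ℝ).hasFDerivAt
  have hd : HasFDerivAt antipodalQuotient (ContinuousLinearMap.pi fun i =>
      ContinuousLinearMap.pi fun j => p i • (EuclideanSpace.proj j : E3 →L[ℝ] ℝ) +
        p j • (EuclideanSpace.proj i : E3 →L[ℝ] ℝ)) p :=
    hasFDerivAt_pi.2 fun i => hasFDerivAt_pi.2 fun j => (h i).mul (h j)
  rw [hd.fderiv]
  ext i
  simp [contraction_apply, contractedDerivative, PiLp.inner_apply, Fin.sum_univ_three,
    -inner_self_eq_norm_sq_to_K]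
  ring

theorem contractedDerivative_add_smul (p w w' : E3) (t : ℝ) :
    contractedDerivative p w + t • contractedDerivative p w' =
      contractedDerivative p (w + t • w') := by
  simp only [contractedDerivative, inner_add_right, inner_smul_right]
  module

/-- Pairing with `w` gives `|p|²|w|² + ⟨p, w⟩² = 0`. In particular `p ↦ p pᵀ` is an immersion off
the origin. -/
theorem contractedDerivative_eq_zero {p w : E3} (hp : p ≠ 0) (h : contractedDerivative p w = 0) :
    w = 0 := by
  have h1 : inner ℝ w (contractedDerivative p w) = 0 := by rw [h, inner_zero_right]
  rw [contractedDerivative, inner_add_right, inner_smul_right, inner_smul_right,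
    real_inner_comm p w] at h1
  have h2 : 0 < inner ℝ p p := real_inner_self_pos.2 hp
  have h3 : 0 ≤ inner ℝ w w := real_inner_self_nonneg
  have h4 : inner ℝ p p * inner ℝ w w = 0 :=
    le_antisymm (by nlinarith [mul_self_nonneg (inner ℝ p w)]) (mul_nonneg h2.le h3)
  exact inner_self_eq_zero.1 ((mul_eq_zero.1 h4).resolve_left h2.ne')

theorem contractedDerivative_neg_neg (p w : E3) :
    contractedDerivative (-p) (-w) = -contractedDerivative p w := by
  simp [contractedDerivative, add_comm]

/-- A smooth local section of the antipodal quotient map about `q`. -/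
def antipodalSection (q : E3) (m : Fin 3 → Fin 3 → ℝ) : E3 :=
  (Real.sqrt (inner ℝ q (contraction q m)))⁻¹ • contraction q m

theorem inner_contraction_antipodalQuotient (p q : E3) :
    inner ℝ q (contraction q (antipodalQuotient p)) = inner ℝ p q ^ 2 := by
  rw [contraction_antipodalQuotient, inner_smul_right, real_inner_comm q p, sq]

/-- Contracting `p pᵀ` with `q` gives `⟨p, q⟩ p`, and the square root in the definition is `|⟨p,
q⟩|`. -/
theorem antipodalSection_eq_or {p q : E3} (h : inner ℝ p q ≠ 0) :
    antipodalSection q (antipodalQuotient p) = p ∨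
      antipodalSection q (antipodalQuotient p) = -p := by
  rw [antipodalSection, inner_contraction_antipodalQuotient, Real.sqrt_sq_eq_abs,
    contraction_antipodalQuotient, smul_smul]
  rcases lt_or_gt_of_ne h with h' | h'
  · right
    rw [abs_of_neg h', inv_neg, neg_mul, inv_mul_cancel₀ h, neg_one_smul]
  · left
    rw [abs_of_pos h', inv_mul_cancel₀ h, one_smul]

theorem antipodalSection_self {p : E3} (hp : p ≠ 0) :
    antipodalSection p (antipodalQuotient p) = p := by
  have h : 0 < inner ℝ p p := real_inner_self_pos.2 hp
  rw [antipodalSection, inner_contraction_antipodalQuotient, Real.sqrt_sq_eq_abs,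
    contraction_antipodalQuotient, smul_smul, abs_of_pos h, inv_mul_cancel₀ h.ne', one_smul]

theorem contDiffAt_antipodalSection {p : E3} (hp : p ≠ 0) :
    ContDiffAt ℝ ∞ (antipodalSection p) (antipodalQuotient p) := by
  have h : 0 < inner ℝ p p := real_inner_self_pos.2 hp
  have h1 : ContDiff ℝ ∞ fun m => contraction p m := (contraction p).contDiff
  have h2 : ContDiffAt ℝ ∞ (fun m => inner ℝ p (contraction p m)) (antipodalQuotient p) :=
    (contDiff_const.inner ℝ h1).contDiffAt
  have hpos : 0 < inner ℝ p (contraction p (antipodalQuotient p)) := by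
    rw [inner_contraction_antipodalQuotient]
    positivity
  exact ((h2.sqrt hpos.ne').inv (Real.sqrt_pos.2 hpos).ne').smul h1.contDiffAt

/-! ### Orienting along the fibre -/

/-- The linear algebra at a point of a fibre: `A` is the differential of the fibration, `a` that of
the parametrization of the fibre by the model surface with conormal `δ`, and `D` that of its inverse
modulo the antipodal map. -/
theorem ker_eq_of_fiber {A : E4 →L[ℝ] E2} (hA : Function.Surjective A) {a : E3 →L[ℝ] E4}
    {δ : E3 →L[ℝ] ℝ} (hδ : δ ≠ 0) {D : E4 →L[ℝ] (Fin 3 → Fin 3 → ℝ)} {p : E3} (hp : p ≠ 0)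
    (hAa : ∀ w, δ w = 0 → A (a w) = 0)
    (hD : ∀ w, δ w = 0 → D (a w) = fderiv ℝ antipodalQuotient p w) {v : E4} (hv : A v = 0) :
    ∃ w, δ w = 0 ∧ a w = v := by
  let L : δ.ker →ₗ[ℝ] A.ker :=
    (a.toLinearMap ∘ₗ δ.ker.subtype).codRestrict A.ker fun w => hAa w.1 w.2
  -- `D ∘ a` contracted with `p` is the injective map `contractedDerivative p` on the kernel of `δ`;
  -- both kernels have dimension two, so `L` is also onto.
  have hinj : Function.Injective L := by
    refine LinearMap.ker_eq_bot.1 (LinearMap.ker_eq_bot'.2 fun w hw => ?_)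
    have h1 : a w.1 = 0 := congrArg Subtype.val hw
    have h2 := hD w.1 w.2
    rw [h1, map_zero] at h2
    have h3 := contraction_fderiv_antipodalQuotient p w.1
    rw [← h2, map_zero] at h3
    exact Subtype.ext (contractedDerivative_eq_zero hp h3.symm)
  have hA' : Module.finrank ℝ A.ker = 2 := by
    have h := A.toLinearMap.finrank_range_add_finrank_ker
    rw [LinearMap.range_eq_top.2 hA, finrank_top] at h
    simp only [finrank_euclideanSpace, Fintype.card_fin] at h
    exact Nat.add_left_cancel h
  have hδ' : Module.finrank ℝ δ.ker = 2 := by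
    have hs : Function.Surjective δ.toLinearMap :=
      LinearMap.surjective fun h => hδ (ContinuousLinearMap.coe_injective h)
    have h := δ.toLinearMap.finrank_range_add_finrank_ker
    rw [LinearMap.range_eq_top.2 hs, finrank_top] at h
    simp only [finrank_euclideanSpace, Fintype.card_fin, Module.finrank_self] at h
    omega
  have hsurj := (LinearMap.injective_iff_surjective_of_finrank_eq_finrank
    (hδ'.trans hA'.symm)).1 hinj
  obtain ⟨w, hw⟩ := hsurj ⟨v, hv⟩
  exact ⟨w.1, w.2, congrArg Subtype.val hw⟩

/-- A kernel vector has `v = a w` with `w` tangent to the surface, and then `w + t n = 0`; since `n`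
is transverse to the surface, both terms vanish. -/
theorem frameDet_ne_zero_of_fiber {A : E4 →L[ℝ] E2} (hA : Function.Surjective A) {a : E3 →L[ℝ] E4}
    {δ : E3 →L[ℝ] ℝ} {n : E3} (hn : δ n ≠ 0) {D : E4 →L[ℝ] (Fin 3 → Fin 3 → ℝ)} {p : E3}
    (hp : p ≠ 0) (hAa : ∀ w, δ w = 0 → A (a w) = 0)
    (hD : ∀ w, δ w = 0 → D (a w) = fderiv ℝ antipodalQuotient p w) :
    frameDet A ((contraction p).comp D) (contractedDerivative p n) ≠ 0 := by
  refine frameDet_ne_zero fun v t hv ht => ?_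
  have hδ : δ ≠ 0 := by rintro rfl; exact hn rfl
  obtain ⟨w, hw, rfl⟩ := ker_eq_of_fiber hA hδ hp hAa hD hv
  change contraction p (D (a w)) + _ = 0 at ht
  rw [hD w hw, contraction_fderiv_antipodalQuotient, contractedDerivative_add_smul] at ht
  have h1 := contractedDerivative_eq_zero hp ht
  have h2 : t = 0 := by
    have h3 := congrArg δ h1
    rw [map_add, hw, zero_add, map_smul, map_zero, smul_eq_mul] at h3
    exact (mul_eq_zero.1 h3).resolve_right hn
  rw [h2, zero_smul, add_zero] at h1
  exact ⟨by rw [h1, map_zero], h2⟩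

end Frame

end

noncomputable section

/-! ### Regular fibres -/

section Fiber

local notation "E2" => EuclideanSpace ℝ (Fin 2)
local notation "E3" => EuclideanSpace ℝ (Fin 3)
local notation "E4" => EuclideanSpace ℝ (Fin 4)
local notation "M3" => Fin 3 → Fin 3 → ℝ

/-- The gradient of the function defining `Σ_g`. -/
def surfaceNormal (g : ℕ) (p : E3) : E3 :=
  (InnerProductSpace.toDual ℝ E3).symm (fderiv ℝ (surfaceFunction g) p)

theorem fderiv_surfaceNormal_ne_zero {g : ℕ} {p : E3} (hp : p ∈ orientableSurface g) :
    fderiv ℝ (surfaceFunction g) p (surfaceNormal g p) ≠ 0 := by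
  rw [← InnerProductSpace.toDual_symm_apply (𝕜 := ℝ)]
  have h : surfaceNormal g p ≠ 0 := fun h => fderiv_surfaceFunction_ne_zero hp
    ((InnerProductSpace.toDual ℝ E3).symm.map_eq_zero_iff.1 h)
  exact (real_inner_self_pos.2 h).ne'

/-- The gradient of an even function is odd. -/
theorem surfaceNormal_neg (g : ℕ) (p : E3) : surfaceNormal g (-p) = -surfaceNormal g p := by
  have h : fderiv ℝ (surfaceFunction g) p = -fderiv ℝ (surfaceFunction g) (-p) := by
    have h1 := (hasStrictFDerivAt_surfaceFunction g (-p)).hasFDerivAt.comp p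
      (hasFDerivAt_id p).neg
    have h2 : surfaceFunction g ∘ Neg.neg = surfaceFunction g :=
      funext fun q => surfaceFunction_neg g q
    rw [h2] at h1
    rw [(hasStrictFDerivAt_surfaceFunction g p).hasFDerivAt.unique h1]
    ext1 v
    simp
  rw [surfaceNormal, surfaceNormal, h, map_neg, neg_neg]

theorem continuous_surfaceNormal (g : ℕ) : Continuous (surfaceNormal g) :=
  (InnerProductSpace.toDual ℝ E3).symm.continuous.comp
    ((contDiff_surfaceFunction g).continuous_fderiv (by simp))

theorem ne_zero_of_mem_orientableSurface {g : ℕ} {p : E3} (hp : p ∈ orientableSurface g) :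
    p ≠ 0 := by
  rintro rfl
  exact zero_notMem_orientableSurface g hp

variable {X S : Type*} [TopologicalSpace X] [ChartedSpace (EuclideanHalfSpace 4) X]
  [TopologicalSpace S] [ChartedSpace (EuclideanHalfSpace 2) S]

/-- `Φ` and `Ψ` are mutually inverse diffeomorphisms between the regular fibre of `f` over `y` and
the quotient of `Σ_g` by the antipodal map. -/
structure IsFiberParametrization (f : X → S) (y : S) (g : ℕ) (Φ : X → M3) (Ψ : M3 → X) :
    Prop where
  smooth : ContMDiff (𝓡∂ 4) (𝓡∂ 2) ∞ f
  regular : ∀ x, f x = y → Function.Surjective (mfderiv (𝓡∂ 4) (𝓡∂ 2) f x)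
  smooth_to : ContMDiffOn (𝓡∂ 4) 𝓘(ℝ, M3) ∞ Φ (f ⁻¹' {y})
  smooth_inv : ContMDiffOn 𝓘(ℝ, M3) (𝓡∂ 4) ∞ Ψ (antipodalQuotient '' orientableSurface g)
  mapsTo : MapsTo Φ (f ⁻¹' {y}) (antipodalQuotient '' orientableSurface g)
  mapsTo_inv : MapsTo Ψ (antipodalQuotient '' orientableSurface g) (f ⁻¹' {y})
  left_inv : LeftInvOn Ψ Φ (f ⁻¹' {y})
  right_inv : RightInvOn Ψ Φ (antipodalQuotient '' orientableSurface g)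

variable (f : X → S) (y : S) (g : ℕ) (Φ : X → M3) (Ψ : M3 → X)

/-- The differential of `f` at a point of the fibre over `y`, in the chart at `y`. -/
def chartDeriv (x : X) : E4 →L[ℝ] E2 :=
  mfderiv (𝓡∂ 4) 𝓘(ℝ, E2) (extChartAt (𝓡∂ 2) y ∘ f) x

/-- A derivative of `Φ` along the fibre over `y`. -/
def fiberDeriv (x : X) : E4 →L[ℝ] M3 :=
  mfderivWithin (𝓡∂ 4) 𝓘(ℝ, M3) Φ (f ⁻¹' {y}) x

/-- The determinant deciding how a point `p` of the model surface orients the tangent space of the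
total space at `x`. -/
def fiberDet (x : X) (p : E3) : ℝ :=
  frameDet (chartDeriv f y x) ((contraction p).comp (fiberDeriv f y Φ x))
    (contractedDerivative p (surfaceNormal g p))

/-- The orientation of the model space with the given sign. -/
def signOrientation (d : ℝ) : Orientation ℝ E4 (Fin 4) :=
  open Classical in if 0 < d then (EuclideanSpace.basisFun (Fin 4) ℝ).toBasis.orientation
    else -(EuclideanSpace.basisFun (Fin 4) ℝ).toBasis.orientation

/-- The lift to the orientation cover of the parametrization of a regular fibre. -/
def fiberLift (p : E3) : OrientationCover (𝓡∂ 4) X :=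
  ⟨Ψ (antipodalQuotient p), signOrientation (fiberDet f y g Φ (Ψ (antipodalQuotient p)) p)⟩

/-- At `d = 0` the default is the negative orientation on both sides, hence the hypothesis. -/
theorem signOrientation_neg {d : ℝ} (hd : d ≠ 0) : signOrientation (-d) = -signOrientation d := by
  unfold signOrientation
  rcases lt_or_gt_of_ne hd with h | h
  · rw [if_pos (neg_pos.2 h), if_neg h.not_gt]
    exact (neg_neg ((EuclideanSpace.basisFun (Fin 4) ℝ).toBasis.orientation)).symm
  · rw [if_neg (neg_neg_of_pos h).not_gt, if_pos h]

theorem signOrientation_congr {d d' : ℝ} (h : 0 < d ↔ 0 < d') :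
    signOrientation d = signOrientation d' := by
  unfold signOrientation
  rw [if_congr h rfl rfl]

/-- Here `d` is a determinant in a fixed chart and `d * C.det` the same one in the preferred chart;
transport by `C` cancels the sign of `C.det`. -/
theorem transportOrientation_signOrientation {C : E4 →L[ℝ] E4} {d : ℝ} (hC : C.det ≠ 0)
    (hd : d ≠ 0) : transportOrientation C (signOrientation (d * C.det)) = signOrientation d := by
  unfold transportOrientation
  rcases lt_or_gt_of_ne hC with h | h
  · rw [if_neg h.not_gt, signOrientation_congr (d' := -d), signOrientation_neg hd]
    · exact neg_neg (signOrientation d)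
    · rw [neg_pos, mul_pos_iff]
      constructor
      · rintro (h' | h')
        · exact absurd h'.2 h.not_gt
        · exact h'.1
      · exact fun h' => Or.inr ⟨h', h⟩
  · rw [if_pos h, signOrientation_congr (d' := d)]
    exact mul_pos_iff_of_pos_right h

attribute [irreducible] frameDet

theorem tendsto_frameDet {g : ℕ} {ι : Type*} {l : Filter ι} {A : ι → E4 →L[ℝ] E2}
    {D : ι → E4 →L[ℝ] M3} {p : ι → E3} {A₀ : E4 →L[ℝ] E2} {D₀ : E4 →L[ℝ] M3} {p₀ : E3}
    (hA : Tendsto A l (𝓝 A₀)) (hD : Tendsto D l (𝓝 D₀)) (hp : Tendsto p l (𝓝 p₀)) :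
    Tendsto (fun i => frameDet (A i) ((contraction (p i)).comp (D i))
      (contractedDerivative (p i) (surfaceNormal g (p i)))) l
      (𝓝 (frameDet A₀ ((contraction p₀).comp D₀)
        (contractedDerivative p₀ (surfaceNormal g p₀)))) := by
  have h2 : Continuous fun p => contractedDerivative p (surfaceNormal g p) := by
    have := continuous_surfaceNormal g
    unfold contractedDerivative
    fun_prop
  have h1 : Continuous fun a : (E4 →L[ℝ] E2) × (E4 →L[ℝ] M3) × E3 =>
      (a.1, (contraction a.2.2).comp a.2.1, contractedDerivative a.2.2 (surfaceNormal g a.2.2)) :=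
    continuous_fst.prodMk (((contraction.continuous.comp continuous_snd.snd).clm_comp
      continuous_snd.fst).prodMk (h2.comp continuous_snd.snd))
  exact ((continuous_frameDet.comp h1).tendsto (A₀, D₀, p₀)).comp
    (hA.prodMk_nhds (hD.prodMk_nhds hp))

namespace IsFiberParametrization

variable {f y g Φ Ψ} (P : IsFiberParametrization f y g Φ Ψ)
include P

theorem mem_fiber {p : E3} (hp : p ∈ orientableSurface g) :
    f (Ψ (antipodalQuotient p)) = y :=
  P.mapsTo_inv (mem_image_of_mem _ hp)

theorem contMDiffOn_param :
    ContMDiffOn 𝓘(ℝ, E3) (𝓡∂ 4) ∞ (Ψ ∘ antipodalQuotient) (orientableSurface g) :=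
  P.smooth_inv.comp contDiff_antipodalQuotient.contMDiff.contMDiffOn
    fun _ hp => mem_image_of_mem _ hp

theorem mdifferentiableAt_chart [IsManifold (𝓡∂ 2) ∞ S] {x : X} (hx : f x = y) :
    MDifferentiableAt (𝓡∂ 4) 𝓘(ℝ, E2) (extChartAt (𝓡∂ 2) y ∘ f) x := by
  refine MDifferentiableAt.comp x (mdifferentiableAt_extChartAt ?_)
    (P.smooth.mdifferentiable (by simp) x)
  rw [hx]
  exact mem_chart_source _ y

theorem surjective_chart [IsManifold (𝓡∂ 2) ∞ S] {x : X} (hx : f x = y) :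
    Function.Surjective (chartDeriv f y x) := by
  have hs : f x ∈ (chartAt (EuclideanHalfSpace 2) y).source := by
    rw [hx]
    exact mem_chart_source _ y
  have h1 := mfderiv_comp x (mdifferentiableAt_extChartAt hs)
    (P.smooth.mdifferentiable (by simp) x)
  obtain ⟨L, hL⟩ := isInvertible_mfderiv_extChartAt (I := 𝓡∂ 2) (x := y) (y := f x)
    (by rwa [extChartAt_source])
  rw [chartDeriv, h1, ← hL]
  exact L.surjective.comp (P.regular x hx)

/-- The linear algebra of a fibre: the differential of the parametrization is tangent to the fibre,
and inverse to that of `Φ` along the surface. -/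
theorem exists_param_derivative [IsManifold (𝓡∂ 2) ∞ S] {p : E3} (hp : p ∈ orientableSurface g) :
    ∃ a : E3 →L[ℝ] E4, (∀ w, fderiv ℝ (surfaceFunction g) p w = 0 →
      chartDeriv f y (Ψ (antipodalQuotient p)) (a w) = 0) ∧
      ∀ D : E4 →L[ℝ] M3, HasMFDerivWithinAt (𝓡∂ 4) 𝓘(ℝ, M3) Φ (f ⁻¹' {y})
        (Ψ (antipodalQuotient p)) D → ∀ w, fderiv ℝ (surfaceFunction g) p w = 0 →
        D (a w) = fderiv ℝ antipodalQuotient p w := by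
  have ha := (P.contMDiffOn_param.mdifferentiableOn (by simp) p hp).hasMFDerivWithinAt
  let a : E3 →L[ℝ] E4 :=
    mfderivWithin 𝓘(ℝ, E3) (𝓡∂ 4) (Ψ ∘ antipodalQuotient) (orientableSurface g) p
  refine ⟨a, fun w hw => ?_, fun D hD w hw => ?_⟩
  · have h1 : HasFDerivWithinAt ((extChartAt (𝓡∂ 2) y ∘ f) ∘ (Ψ ∘ antipodalQuotient))
        ((chartDeriv f y (Ψ (antipodalQuotient p))).comp a) (orientableSurface g) p :=
      ((P.mdifferentiableAt_chart (P.mem_fiber hp)).hasMFDerivAt.comp_hasMFDerivWithinAt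
        p ha).hasFDerivWithinAt
    -- The composite is constant on the surface, and derivatives within the surface agree on its
    -- tangent directions.
    have h2 : HasFDerivWithinAt ((extChartAt (𝓡∂ 2) y ∘ f) ∘ (Ψ ∘ antipodalQuotient))
        (0 : E3 →L[ℝ] E2) (orientableSurface g) p := by
      refine (hasFDerivWithinAt_const (extChartAt (𝓡∂ 2) y y) p _).congr (fun q hq => ?_) ?_
      · exact congrArg (extChartAt (𝓡∂ 2) y) (P.mem_fiber hq)
      · exact congrArg (extChartAt (𝓡∂ 2) y) (P.mem_fiber hp)
    exact h1.unique_on h2 (mem_tangentConeAt_orientableSurface hp hw)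
  · have h1 : HasFDerivWithinAt (Φ ∘ (Ψ ∘ antipodalQuotient)) (D.comp a)
        (orientableSurface g) p :=
      (HasMFDerivWithinAt.comp (I' := 𝓡∂ 4) (u := f ⁻¹' {y}) p hD ha
        fun q hq => P.mem_fiber hq).hasFDerivWithinAt
    have h2 : HasFDerivWithinAt (Φ ∘ (Ψ ∘ antipodalQuotient))
        (fderiv ℝ antipodalQuotient p) (orientableSurface g) p := by
      refine ((contDiff_antipodalQuotient.differentiable (by simp) p).hasFDerivAt
        |>.hasFDerivWithinAt).congr (fun q hq => ?_) ?_
      · exact P.right_inv (mem_image_of_mem _ hq)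
      · exact P.right_inv (mem_image_of_mem _ hp)
    exact h1.unique_on h2 (mem_tangentConeAt_orientableSurface hp hw)

theorem hasMFDerivWithinAt_to {x : X} (hx : f x = y) :
    HasMFDerivWithinAt (𝓡∂ 4) 𝓘(ℝ, M3) Φ (f ⁻¹' {y}) x
      (fiberDeriv f y Φ x) :=
  (P.smooth_to.mdifferentiableOn (by simp) x hx).hasMFDerivWithinAt

theorem frameDet_ne_zero [IsManifold (𝓡∂ 2) ∞ S] {p : E3} (hp : p ∈ orientableSurface g) {D : E4 →L[ℝ] M3}
    (hD : HasMFDerivWithinAt (𝓡∂ 4) 𝓘(ℝ, M3) Φ (f ⁻¹' {y}) (Ψ (antipodalQuotient p)) D) :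
    frameDet (chartDeriv f y (Ψ (antipodalQuotient p)))
      ((contraction p).comp D) (contractedDerivative p (surfaceNormal g p)) ≠ 0 := by
  obtain ⟨a, h1, h2⟩ := P.exists_param_derivative hp
  exact frameDet_ne_zero_of_fiber (P.surjective_chart (P.mem_fiber hp))
    (fderiv_surfaceNormal_ne_zero hp) (ne_zero_of_mem_orientableSurface hp) h1 (h2 D hD)

theorem fiberDet_ne_zero [IsManifold (𝓡∂ 2) ∞ S] {p : E3} (hp : p ∈ orientableSurface g) :
    fiberDet f y g Φ (Ψ (antipodalQuotient p)) p ≠ 0 :=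
  P.frameDet_ne_zero hp (P.hasMFDerivWithinAt_to (P.mem_fiber hp))

/-- The sign of the determinant can be computed with any derivative of `Φ` along the fibre. -/
theorem fiberDet_pos_iff [IsManifold (𝓡∂ 2) ∞ S] {p : E3} (hp : p ∈ orientableSurface g) {D : E4 →L[ℝ] M3}
    (hD : HasMFDerivWithinAt (𝓡∂ 4) 𝓘(ℝ, M3) Φ (f ⁻¹' {y}) (Ψ (antipodalQuotient p)) D) :
    0 < fiberDet f y g Φ (Ψ (antipodalQuotient p)) p ↔
    0 < frameDet (chartDeriv f y (Ψ (antipodalQuotient p)))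
      ((contraction p).comp D) (contractedDerivative p (surfaceNormal g p)) := by
  have hδ : fderiv ℝ (surfaceFunction g) p ≠ 0 := fderiv_surfaceFunction_ne_zero hp
  have hp0 := ne_zero_of_mem_orientableSurface hp
  have hA := P.surjective_chart (P.mem_fiber hp)
  refine frameDet_pos_iff_of_eqOn_ker hA _ fun v hv => ?_
  obtain ⟨a, h1, h2⟩ := P.exists_param_derivative hp
  obtain ⟨w, hw, rfl⟩ := ker_eq_of_fiber hA hδ hp0 h1 (h2 D hD) hv
  exact congrArg (contraction p)
    ((h2 _ (P.hasMFDerivWithinAt_to (P.mem_fiber hp)) w hw).trans (h2 D hD w hw).symm)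

/-- The base point depends only on `p pᵀ`, whereas the contraction with `p` and the contracted
normal both change sign, hence so does the determinant. -/
theorem fiberLift_neg [IsManifold (𝓡∂ 2) ∞ S] {p : E3} (hp : p ∈ orientableSurface g) :
    fiberLift f y g Φ Ψ (-p) = OrientationCover.deck (fiberLift f y g Φ Ψ p) := by
  have h1 (x : X) : fiberDet f y g Φ x (-p) = -fiberDet f y g Φ x p := by
    unfold fiberDet
    rw [surfaceNormal_neg, contractedDerivative_neg_neg, ← frameDet_neg, map_neg]
    rfl
  unfold fiberLift
  rw [antipodalQuotient_neg]
  refine congrArg (OrientationCover.mk (I := 𝓡∂ 4) (Ψ (antipodalQuotient p))) ?_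
  rw [h1]
  exact signOrientation_neg (P.fiberDet_ne_zero hp)

theorem continuousWithinAt_param {p : E3} (hp : p ∈ orientableSurface g) :
    Tendsto (Ψ ∘ antipodalQuotient) (𝓝[orientableSurface g] p)
      (𝓝[f ⁻¹' {y}] (Ψ (antipodalQuotient p))) :=
  tendsto_nhdsWithin_of_tendsto_nhds_of_eventually_within _
    (P.contMDiffOn_param.continuousOn p hp)
    (by filter_upwards [self_mem_nhdsWithin] with q hq using P.mem_fiber hq)

/-- Near `p₀` the lift stays in one sheet, because in a fixed chart the determinant is continuous
and nonzero, so of constant sign. -/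
theorem continuousOn_fiberLift [IsManifold (𝓡∂ 4) ∞ X] [IsManifold (𝓡∂ 2) ∞ S] :
    ContinuousOn (fiberLift f y g Φ Ψ) (orientableSurface g) := by
  intro p₀ hp₀
  let h : E3 → X := fun p => Ψ (antipodalQuotient p)
  have hth : Tendsto h (𝓝[orientableSurface g] p₀) (𝓝[f ⁻¹' {y}] (h p₀)) :=
    P.continuousWithinAt_param hp₀
  have hth' : Tendsto h (𝓝[orientableSurface g] p₀) (𝓝 (h p₀)) := hth.mono_right nhdsWithin_le_nhds
  have hu : ContMDiffAt (𝓡∂ 4) 𝓘(ℝ, E2) 1 (extChartAt (𝓡∂ 2) y ∘ f) (h p₀) := by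
    have h1 : ContMDiffAt (𝓡∂ 2) 𝓘(ℝ, E2) 1 (extChartAt (𝓡∂ 2) y) (f (h p₀)) := by
      rw [show f (h p₀) = y from P.mem_fiber hp₀]
      exact contMDiffAt_extChartAt
    exact h1.comp _ (P.smooth.contMDiffAt.of_le (by simp))
  have hΦ : ContMDiffWithinAt (𝓡∂ 4) 𝓘(ℝ, M3) 1 Φ (f ⁻¹' {y}) (h p₀) :=
    (P.smooth_to _ (P.mem_fiber hp₀)).of_le (by simp)
  obtain ⟨Du, hDu, hu'⟩ := hu.exists_derivative
  obtain ⟨DΦ, hDΦ, hΦ'⟩ := hΦ.exists_derivative (P.mem_fiber hp₀)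
  -- The determinant in the chart at `h p₀`. The derivatives in `fiberDet` are read in charts
  -- varying with the point, and `fiberDeriv` is arbitrary across the fibre; `Du` and `DΦ` are
  -- continuous at `h p₀`.
  let d : E3 → ℝ := fun p => frameDet (Du (h p)) ((contraction p).comp (DΦ (h p)))
    (contractedDerivative p (surfaceNormal g p))
  have hd : Tendsto d (𝓝[orientableSurface g] p₀) (𝓝 (d p₀)) := by
    exact tendsto_frameDet (hDu.tendsto.comp hth') (hDΦ.tendsto.comp hth)
      (tendsto_id'.2 nhdsWithin_le_nhds)
  have key : ∀ᶠ p in 𝓝[orientableSurface g] p₀,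
      h p ∈ (chartAt (EuclideanHalfSpace 4) (h p₀)).source ∧ d p ≠ 0 ∧
      transportOrientation (chartChange (𝓡∂ 4) (achart _ (h p)) (achart _ (h p₀)) (h p))
        (signOrientation (fiberDet f y g Φ (h p) p)) = signOrientation (d p) := by
    filter_upwards [self_mem_nhdsWithin, hth.eventually hΦ', hth'.eventually hu', hth'
      ((chartAt (EuclideanHalfSpace 4) (h p₀)).open_source.mem_nhds (mem_chart_source _ (h p₀)))]
      with p hp h1 h2 h3
    let C : E4 →L[ℝ] E4 := chartChange (𝓡∂ 4) (achart _ (h p)) (achart _ (h p₀)) (h p)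
    have hC : C.det ≠ 0 := chartChange_det_ne_zero _ _ _ (mem_chart_source _ (h p)) h3
    have hA : chartDeriv f y (h p) = (Du (h p)).comp C := h2.mfderiv
    have e1 := P.fiberDet_pos_iff hp h1
    have e2 := P.frameDet_ne_zero hp h1
    have e3 : frameDet (chartDeriv f y (h p)) ((contraction p).comp ((DΦ (h p)).comp C))
        (contractedDerivative p (surfaceNormal g p)) = d p * C.det := by
      rw [hA]
      exact frameDet_comp (Du (h p)) ((contraction p).comp (DΦ (h p))) _ C
    have e4 : 0 < fiberDet f y g Φ (h p) p ↔ 0 < d p * C.det := by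
      rw [← e3]
      exact e1
    have e5 : d p ≠ 0 := by
      have : d p * C.det ≠ 0 := by
        rw [← e3]
        exact e2
      exact left_ne_zero_of_mul this
    refine ⟨h3, e5, ?_⟩
    rw [signOrientation_congr e4]
    exact transportOrientation_signOrientation hC e5
  have key₀ := key.self_of_nhdsWithin hp₀
  have hsign : ∀ᶠ p in 𝓝[orientableSurface g] p₀, (0 < d p ↔ 0 < d p₀) := by
    rcases lt_or_gt_of_ne key₀.2.1 with h0 | h0
    · filter_upwards [hd.eventually_lt_const h0] with p hp
      exact ⟨fun h' => absurd h' hp.not_gt, fun h' => absurd h' h0.not_gt⟩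
    · filter_upwards [hd.eventually_const_lt h0] with p hp
      exact ⟨fun _ => h0, fun _ => hp⟩
  refine OrientationCover.continuousWithinAt_of_proj (e := achart _ (h p₀))
    (o := signOrientation (d p₀)) hp₀ hth' ?_
  filter_upwards [key, hsign] with p hp hs
  exact ⟨hp.1, hp.2.2.trans (signOrientation_congr hs)⟩

end IsFiberParametrization

end Fiber

end

noncomputable section

/-! ### The lifted parametrization as a diffeomorphism onto the fibre of the cover -/

section Fiber

local notation "E3" => EuclideanSpace ℝ (Fin 3)
local notation "M3" => Fin 3 → Fin 3 → ℝ

variable {X S : Type*} [TopologicalSpace X] [ChartedSpace (EuclideanHalfSpace 4) X]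
  [TopologicalSpace S] [ChartedSpace (EuclideanHalfSpace 2) S]
  {f : X → S} {y : S} {g : ℕ} {Φ : X → M3} {Ψ : M3 → X}

namespace IsFiberParametrization

variable (P : IsFiberParametrization f y g Φ Ψ)
include P

theorem to_fiberLift {p : E3} (hp : p ∈ orientableSurface g) :
    Φ (OrientationCover.proj (𝓡∂ 4) X (fiberLift f y g Φ Ψ p)) = antipodalQuotient p :=
  P.right_inv (mem_image_of_mem _ hp)

variable [IsManifold (𝓡∂ 2) ∞ S]

/-- The base point determines `p` up to sign, and `-p` lifts to the other point over it. -/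
theorem injOn_fiberLift : InjOn (fiberLift f y g Φ Ψ) (orientableSurface g) := by
  intro p hp q hq hpq
  have h : antipodalQuotient p = antipodalQuotient q := by
    rw [← P.to_fiberLift hp, hpq, P.to_fiberLift hq]
  rcases eq_or_eq_neg_of_antipodalQuotient_eq (ne_zero_of_mem_orientableSurface hp) h with h | h
  · exact h.symm
  · rw [h, P.fiberLift_neg hp] at hpq
    exact absurd hpq.symm (OrientationCover.deck_ne _)

theorem exists_fiberLift_eq {q : OrientationCover (𝓡∂ 4) X}
    (hq : f (OrientationCover.proj (𝓡∂ 4) X q) = y) :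
    ∃ p ∈ orientableSurface g, fiberLift f y g Φ Ψ p = q := by
  obtain ⟨p, hp, hpq⟩ := P.mapsTo hq
  have h : OrientationCover.proj (𝓡∂ 4) X (fiberLift f y g Φ Ψ p) =
      OrientationCover.proj (𝓡∂ 4) X q := by
    change Ψ (antipodalQuotient p) = _
    rw [hpq]
    exact P.left_inv hq
  rcases OrientationCover.eq_or_eq_deck h with h | h
  · exact ⟨p, hp, h⟩
  · refine ⟨-p, neg_mem_orientableSurface hp, ?_⟩
    rw [P.fiberLift_neg hp, h, OrientationCover.deck_deck]

variable [IsManifold (𝓡∂ 4) ∞ X]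

theorem contMDiffOn_fiberLift :
    ContMDiffOn 𝓘(ℝ, E3) (𝓡∂ 4) ∞ (fiberLift f y g Φ Ψ) (orientableSurface g) :=
  fun p hp => OrientationCover.contMDiffWithinAt_of_proj (P.continuousOn_fiberLift p hp)
    (P.contMDiffOn_param p hp)

/-- Any inverse of the lift of the parametrization is smooth. -/
theorem contMDiffOn_of_fiberLift_rightInverse {u : OrientationCover (𝓡∂ 4) X → E3}
    (hu : ∀ q, f (OrientationCover.proj (𝓡∂ 4) X q) = y →
      u q ∈ orientableSurface g ∧ fiberLift f y g Φ Ψ (u q) = q) :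
    ContMDiffOn (𝓡∂ 4) 𝓘(ℝ, E3) ∞ u ((f ∘ OrientationCover.proj (𝓡∂ 4) X) ⁻¹' {y}) := by
  intro q₀ hq₀
  let Z : Set (OrientationCover (𝓡∂ 4) X) := (f ∘ OrientationCover.proj (𝓡∂ 4) X) ⁻¹' {y}
  obtain ⟨hp₀, hl₀⟩ := hu q₀ hq₀
  set p₀ := u q₀ with hp₀def
  have hne := ne_zero_of_mem_orientableSurface hp₀
  let k : OrientationCover (𝓡∂ 4) X → M3 := Φ ∘ OrientationCover.proj (𝓡∂ 4) X
  have hku (q) (hq : q ∈ Z) : k q = antipodalQuotient (u q) := by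
    have := P.to_fiberLift (hu q hq).1
    rwa [(hu q hq).2] at this
  have hk : ContMDiffWithinAt (𝓡∂ 4) 𝓘(ℝ, M3) ∞ k Z q₀ :=
    (P.smooth_to _ hq₀).comp q₀ OrientationCover.contMDiff_proj.contMDiffAt.contMDiffWithinAt
      fun _ h => h
  have hσ : ContMDiffAt 𝓘(ℝ, M3) 𝓘(ℝ, E3) ∞ (antipodalSection p₀) (k q₀) := by
    rw [hku q₀ hq₀]
    exact (contDiffAt_antipodalSection hne).contMDiffAt
  -- The smooth local candidate for `u`; it agrees with `u` up to sign near `q₀`, and it remains to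
  -- exclude the wrong sign.
  have hσk : ContMDiffWithinAt (𝓡∂ 4) 𝓘(ℝ, E3) ∞ (antipodalSection p₀ ∘ k) Z q₀ :=
    hσ.comp_contMDiffWithinAt q₀ hk
  have hσk₀ : antipodalSection p₀ (k q₀) = p₀ := by
    rw [hku q₀ hq₀]
    exact antipodalSection_self hne
  have hin : ∀ᶠ q in 𝓝[Z] q₀, inner ℝ (u q) p₀ ≠ 0 := by
    have hc : ContinuousWithinAt (fun q => inner ℝ p₀ (contraction p₀ (k q))) Z q₀ :=
      (Continuous.inner continuous_const (contraction p₀).continuous).continuousAt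
        |>.comp_continuousWithinAt hk.continuousWithinAt
    have h0 : inner ℝ p₀ (contraction p₀ (k q₀)) ≠ 0 := by
      rw [hku q₀ hq₀, inner_contraction_antipodalQuotient]
      exact pow_ne_zero 2 (real_inner_self_pos.2 hne).ne'
    filter_upwards [hc.eventually_ne h0, self_mem_nhdsWithin] with q hq hqZ h
    rw [hku q hqZ, inner_contraction_antipodalQuotient, h] at hq
    exact hq (by norm_num)
  have hmem : ∀ᶠ q in 𝓝[Z] q₀, antipodalSection p₀ (k q) ∈ orientableSurface g ∧
      antipodalQuotient (antipodalSection p₀ (k q)) = antipodalQuotient (u q) := by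
    filter_upwards [hin, self_mem_nhdsWithin] with q hq hqZ
    rw [hku q hqZ]
    rcases antipodalSection_eq_or hq with h | h
    · rw [h]
      exact ⟨(hu q hqZ).1, rfl⟩
    · rw [h, antipodalQuotient_neg]
      exact ⟨neg_mem_orientableSurface (hu q hqZ).1, rfl⟩
  have htσ : Tendsto (fun q => antipodalSection p₀ (k q)) (𝓝[Z] q₀)
      (𝓝[orientableSurface g] p₀) := by
    refine tendsto_nhdsWithin_of_tendsto_nhds_of_eventually_within _ ?_ (hmem.mono fun q h => h.1)
    have := hσk.continuousWithinAt.tendsto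
    rwa [Function.comp_apply, hσk₀] at this
  let s := OrientationCover.sheet (I := 𝓡∂ 4) (achart _ q₀.point) q₀.modelOrientation
  have hs₀ : q₀ ∈ s.source := OrientationCover.mem_sheet_source_self q₀
  have hlift : ∀ᶠ q in 𝓝[Z] q₀, fiberLift f y g Φ Ψ (antipodalSection p₀ (k q)) ∈ s.source := by
    have h1 := (P.continuousOn_fiberLift p₀ hp₀).tendsto.comp htσ
    rw [hl₀] at h1
    exact h1 (s.open_source.mem_nhds hs₀)
  refine hσk.congr_of_eventuallyEq ?_ hσk₀.symm
  filter_upwards [hlift, hmem, self_mem_nhdsWithin,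
    mem_nhdsWithin_of_mem_nhds (s.open_source.mem_nhds hs₀)] with q h1 h2 hqZ hqs
  -- The lift of the candidate has the same projection as `q` and, by continuity, lies in the same
  -- sheet, so it equals `q`; injectivity of the lift then fixes the sign.
  refine P.injOn_fiberLift (hu q hqZ).1 h2.1 ?_
  rw [(hu q hqZ).2]
  have hproj : OrientationCover.proj (𝓡∂ 4) X
      (fiberLift f y g Φ Ψ (antipodalSection p₀ (k q))) = OrientationCover.proj (𝓡∂ 4) X q := by
    have h3 : OrientationCover.proj (𝓡∂ 4) X q = Ψ (antipodalQuotient (u q)) := by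
      conv_lhs => rw [← (hu q hqZ).2]
      rfl
    rw [h3, ← h2.2]
    rfl
  refine (OrientationCover.localProj_symm_proj hqs).symm.trans ?_
  rw [← hproj]
  exact OrientationCover.localProj_symm_proj h1

theorem areDiffeomorphic_orientableSurface :
    AreDiffeomorphic (𝓡∂ 4) 𝓘(ℝ, E3) ((f ∘ OrientationCover.proj (𝓡∂ 4) X) ⁻¹' {y})
      (orientableSurface g) := by
  have h (q : OrientationCover (𝓡∂ 4) X) : ∃ p : E3,
      f (OrientationCover.proj (𝓡∂ 4) X q) = y →
        p ∈ orientableSurface g ∧ fiberLift f y g Φ Ψ p = q := by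
    by_cases hq : f (OrientationCover.proj (𝓡∂ 4) X q) = y
    · obtain ⟨p, hp⟩ := P.exists_fiberLift_eq hq
      exact ⟨p, fun _ => hp⟩
    -- Off the fibre the inverse takes an arbitrary value.
    · exact ⟨0, fun h => absurd h hq⟩
  choose u hu using h
  have hmaps : MapsTo (fiberLift f y g Φ Ψ) (orientableSurface g)
      ((f ∘ OrientationCover.proj (𝓡∂ 4) X) ⁻¹' {y}) := fun p hp => P.mem_fiber hp
  refine ⟨u, fiberLift f y g Φ Ψ, P.contMDiffOn_of_fiberLift_rightInverse hu,
    P.contMDiffOn_fiberLift, fun q hq => (hu q hq).1, hmaps, fun q hq => (hu q hq).2,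
    fun p hp => ?_⟩
  exact P.injOn_fiberLift (hu _ (hmaps hp)).1 hp (hu _ (hmaps hp)).2

end IsFiberParametrization

end Fiber

/-! ### Assembly of the orientable Lefschetz fibration -/

namespace OrientationCover

/-- The orientation cover turns a non-orientable Lefschetz fibration into an orientable one. -/
theorem isOrientableLefschetzFibration_comp_proj {X S : Type*}
    [TopologicalSpace X] [ChartedSpace (EuclideanHalfSpace 4) X] [IsManifold (𝓡∂ 4) ∞ X]
    [TopologicalSpace S] [ChartedSpace (EuclideanHalfSpace 2) S]
    {f : X → S} {g : ℕ} (hf : IsNonorientableLefschetzFibration f g) :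
    IsOrientableLefschetzFibration (f ∘ proj (𝓡∂ 4) X) (g - 1) where
  lefschetz := isLefschetzFibration_comp_proj hf.lefschetz hf.total_nonorientable
  total_orientable := isOrientableManifold
  regular_fiber y hy := by
    have := hf.lefschetz.base.smooth
    have hd : MDifferentiable (𝓡∂ 4) (𝓡∂ 2) f := hf.lefschetz.smooth.mdifferentiable (by simp)
    have hy' : y ∉ f '' criticalPoints (𝓡∂ 4) (𝓡∂ 2) f := by
      rintro ⟨x, hx, rfl⟩
      -- Either point over `x` would do: critical values of `f` are critical values of `f ∘ proj`
      -- because `proj` is onto.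
      refine hy ⟨⟨x, (EuclideanSpace.basisFun (Fin 4) ℝ).toBasis.orientation⟩, ?_, rfl⟩
      rw [criticalPoints_comp_proj hd]
      exact hx
    obtain ⟨Φ, Ψ, h1, h2, h3, h4, h5, h6⟩ := hf.regular_fiber y hy'
    exact IsFiberParametrization.areDiffeomorphic_orientableSurface (Φ := Φ) (Ψ := Ψ)
      { smooth := hf.lefschetz.smooth
        regular := fun x hx => not_not.1 fun hc => hy' ⟨x, hc, hx⟩
        smooth_to := h1
        smooth_inv := h2
        mapsTo := h3
        mapsTo_inv := h4
        left_inv := h5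
        right_inv := h6 }

end OrientationCover

end

theorem proposition1p1 {X S : Type*}
    [TopologicalSpace X] [ChartedSpace (EuclideanHalfSpace 4) X] [IsManifold (𝓡∂ 4) ∞ X]
    [TopologicalSpace S] [ChartedSpace (EuclideanHalfSpace 2) S]
    (f : X → S) (g : ℕ) (hf : IsNonorientableLefschetzFibration f g) :
    IsOrientableLefschetzFibration (f ∘ OrientationCover.proj (𝓡∂ 4) X) (g - 1) ∧
    (criticalPoints (𝓡∂ 4) (𝓡∂ 2) (f ∘ OrientationCover.proj (𝓡∂ 4) X)).Finite ∧
    ∀ 𝔬 : ManifoldOrientation (𝓡∂ 4) (OrientationCover (𝓡∂ 4) X),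
      positiveCriticalPoints 𝔬 (f ∘ OrientationCover.proj (𝓡∂ 4) X) ∪
          negativeCriticalPoints 𝔬 (f ∘ OrientationCover.proj (𝓡∂ 4) X) =
        criticalPoints (𝓡∂ 4) (𝓡∂ 2) (f ∘ OrientationCover.proj (𝓡∂ 4) X) ∧
      (positiveCriticalPoints 𝔬 (f ∘ OrientationCover.proj (𝓡∂ 4) X)).ncard =
        (negativeCriticalPoints 𝔬 (f ∘ OrientationCover.proj (𝓡∂ 4) X)).ncard ∧
      ((criticalPoints (𝓡∂ 4) (𝓡∂ 2) f).Nonempty →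
        IsAchiral 𝔬 (f ∘ OrientationCover.proj (𝓡∂ 4) X)) := by
  have hL := OrientationCover.isLefschetzFibration_comp_proj hf.lefschetz hf.total_nonorientable
  have := hL.total.connected
  exact ⟨OrientationCover.isOrientableLefschetzFibration_comp_proj hf, hL.finite_criticalPoints,
    fun 𝔬 => ⟨hL.positive_union_negative 𝔬,
      OrientationCover.ncard_positive_eq_ncard_negative
        (hf.lefschetz.smooth.mdifferentiable (by simp)) 𝔬,
      OrientationCover.isAchiral_comp_proj hf.lefschetz hf.total_nonorientable 𝔬⟩⟩
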